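/- Let $\mathfrak g=\mathfrak g_{\bar 0}\oplus\mathfrak g_{\bar 1}$ be a finite-dimensional Lie superalgebra over $\mathbb C$ (for instance a basic classical simple one), let $f\in\mathfrak g_{\bar 0}$, and let $\Gamma\colon \mathfrak g=\bigoplus_{j\in\frac12\mathbb Z}\mathfrak g_j$ be a good grading for $f$: a grading of the Lie superalgebra $\mathfrak g$ compatible with parity such that $f\in\mathfrak g_{-1}$ and $\mathrm{ad}_f\colon\mathfrak g_j\to\mathfrak g_{j-1}$ is injective for $j\ge\frac12$ and surjective for $j\le\frac12$. Let $\{e,h,f\}\subset\mathfrak g_{\bar 0}$ be an $\mathfrak{sl}_2$-triple ($[e,f]=h$, $[h,e]=2e$, $[h,f]=-2f$) with $e\in\mathfrak g_1$. Put $\mathfrak g_{\ge-1/2}=\bigoplus_{j\ge-1/2}\mathfrak g_j$, $\mathfrak g_+=\bigoplus_{j>0}\mathfrak g_j$, $\mathfrak g^e=\{X\in\mathfrak g\mid [e,X]=0\}$, and let $\mathcal S_f=f+\mathfrak g^e$ be the Slodowy slice. For a commutative $\mathbb C$-superalgebra $A$ and a subspace $W=W_{\bar 0}\oplus W_{\bar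 1}\subset\mathfrak g$ write $W(A)=(A\otimes W)_{\bar 0}$; the affine superspace $f+W$ has the $A$-points $f+W(A)\subset\mathfrak g(A)$. Let $G_+$ be the unipotent algebraic supergroup with Lie superalgebra $\mathfrak g_+$: its $A$-points are the elements $\exp Y$, $Y\in\mathfrak g_+(A)$, multiplied by the Campbell–Hausdorff law, and it acts on $\mathfrak g$ by $gXg^{-1}=\exp(\mathrm{ad}\,Y)(X)$ for $g=\exp Y$, $X\in\mathfrak g(A)$. Then $\mathcal S_f$, $G_+$ and $f+\mathfrak g_{\ge-1/2}$ are affine supervarieties (functors of points $A\mapsto\mathrm{Hom}(R,A)$ for a finitely generated commutative superalgebra $R$), and $$\xi\colon \mathcal S_f\times G_+\to f+\mathfrak g_{\ge-\frac12},\qquad (X,g)\mapsto g^{-1}Xg,$$ is a well-defined isomorphism of affine supervarieties. -/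

import Mathlib

universe u

namespace SuperSlodowy

open Polynomial

/-! ### Truncated exponentials in a filtered ring -/

/-- The exponential `∑ xⁿ / n!` of a nilpotent element `x` of a complex algebra. -/
noncomputable def nilExp {R : Type*} [Ring R] [Algebra ℂ R] (x : R) : R :=
  ∑ n ∈ Finset.range (nilpotencyClass x), ((n.factorial : ℂ)⁻¹) • x ^ n

theorem nilExp_eq {R : Type*} [Ring R] [Algebra ℂ R] {x : R} {K : ℕ} (h : x ^ K = 0) :
    nilExp x = ∑ n ∈ Finset.range K, ((n.factorial : ℂ)⁻¹) • x ^ n := by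
  have hle : nilpotencyClass x ≤ K := csInf_le' h
  refine Finset.sum_subset (Finset.range_mono hle) fun n _ hn => ?_
  rw [Finset.mem_range, not_lt] at hn
  rw [pow_eq_zero_of_le hn (pow_nilpotencyClass ⟨K, h⟩), smul_zero]

theorem nilExp_neg_mul {R : Type*} [Ring R] [Algebra ℂ R] {x : R} (h : IsNilpotent x) :
    nilExp (-x) * nilExp x = 1 := by
  let _ : Module ℚ R := Module.compHom R (algebraMap ℚ ℂ)
  have hq : ∀ (q : ℚ) (r : R), q • r = (q : ℂ) • r := fun _ _ => rfl
  have key : ∀ y : R, nilExp y = IsNilpotent.exp y := by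
    intro y
    unfold nilExp IsNilpotent.exp
    simp only [hq, Rat.cast_inv, Rat.cast_natCast]
  rw [key, key]
  exact IsNilpotent.exp_neg_mul_exp_self h

theorem nilExp_mul_neg {R : Type*} [Ring R] [Algebra ℂ R] {x : R} (h : IsNilpotent x) :
    nilExp x * nilExp (-x) = 1 := by
  simpa using nilExp_neg_mul h.neg

/-- A finite decreasing multiplicative filtration of an algebra. -/
structure Filt {R : Type*} [Ring R] [Algebra ℂ R] (F : ℕ → Submodule ℂ R) (K : ℕ) : Prop where
  two_le : 2 ≤ K
  anti : Antitone F
  one_mem : (1 : R) ∈ F 0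
  mul_mem : ∀ {m n : ℕ} {x y : R}, x ∈ F m → y ∈ F n → x * y ∈ F (m + n)
  eq_zero : ∀ {x : R}, x ∈ F K → x = 0

namespace Filt

variable {R : Type*} [Ring R] [Algebra ℂ R] {F : ℕ → Submodule ℂ R} {K : ℕ}

theorem pow_mem (hF : Filt F K) {x : R} (hx : x ∈ F 1) (n : ℕ) : x ^ n ∈ F n := by
  induction n with
  | zero => simpa using hF.one_mem
  | succ n ih => rw [pow_succ]; exact hF.mul_mem ih hx

theorem pow_eq_zero (hF : Filt F K) {x : R} (hx : x ∈ F 1) : x ^ K = 0 :=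
  hF.eq_zero (hF.pow_mem hx K)

theorem isNilpotent (hF : Filt F K) {x : R} (hx : x ∈ F 1) : IsNilpotent x :=
  ⟨K, hF.pow_eq_zero hx⟩

theorem mul_mem_le (hF : Filt F K) {m n k : ℕ} {x y : R} (hx : x ∈ F m) (hy : y ∈ F n)
    (h : k ≤ m + n) : x * y ∈ F k :=
  hF.anti h (hF.mul_mem hx hy)

theorem nilExp_sub_one_mem (hF : Filt F K) {x : R} (hx : x ∈ F 1) : nilExp x - 1 ∈ F 1 := by
  obtain ⟨k, hk⟩ : ∃ k, K = k + 1 := ⟨K - 1, by have := hF.two_le; omega⟩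
  rw [nilExp_eq (hF.pow_eq_zero hx), hk, Finset.sum_range_succ']
  simp only [Nat.factorial_zero, Nat.cast_one, inv_one, pow_zero, one_smul, add_sub_cancel_right]
  exact Submodule.sum_mem _ fun n _ => Submodule.smul_mem _ _
    (hF.anti (by omega : 1 ≤ n + 1) (hF.pow_mem hx (n + 1)))

theorem nilExp_mem (hF : Filt F K) {x : R} (hx : x ∈ F 1) : nilExp x ∈ F 0 := by
  have h1 := hF.anti (Nat.zero_le 1) (hF.nilExp_sub_one_mem hx)
  simpa using (F 0).add_mem h1 hF.one_mem

theorem add_pow_sub_mem (hF : Filt F K) {x y : R} {p : ℕ} (hp : 1 ≤ p) (hx : x ∈ F 1)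
    (hy : y ∈ F p) (n : ℕ) : (x + y) ^ (n + 1) - x ^ (n + 1) ∈ F (p + n) := by
  induction n with
  | zero => simpa using hy
  | succ n ih =>
    have : (x + y) ^ (n + 1 + 1) - x ^ (n + 1 + 1)
        = ((x + y) ^ (n + 1) - x ^ (n + 1)) * (x + y) + x ^ (n + 1) * y := by
      rw [pow_succ (x + y) (n + 1), pow_succ x (n + 1)]; noncomm_ring
    rw [this]
    exact (F _).add_mem (hF.mul_mem_le ih ((F 1).add_mem hx (hF.anti hp hy)) (by omega))
      (hF.mul_mem_le (hF.pow_mem hx (n + 1)) hy (by omega))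

theorem nilExp_add_sub_mem (hF : Filt F K) {x y : R} {p : ℕ} (hp : 1 ≤ p) (hx : x ∈ F 1)
    (hy : y ∈ F p) : nilExp (x + y) - nilExp x - y ∈ F (p + 1) := by
  obtain ⟨k, hk⟩ : ∃ k, K = k + 1 + 1 := ⟨K - 2, by have := hF.two_le; omega⟩
  have hxy : x + y ∈ F 1 := (F 1).add_mem hx (hF.anti hp hy)
  rw [nilExp_eq (hF.pow_eq_zero hx), nilExp_eq (hF.pow_eq_zero hxy), ← Finset.sum_sub_distrib]
  simp only [← smul_sub]
  rw [hk, Finset.sum_range_succ', Finset.sum_range_succ']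
  simp only [zero_add, pow_one, pow_zero, sub_self, smul_zero, add_zero, Nat.factorial_one,
    Nat.cast_one, inv_one, one_smul, add_sub_cancel_left, add_sub_cancel_right]
  exact Submodule.sum_mem _ fun n _ => Submodule.smul_mem _ _
    (hF.anti (by omega) (hF.add_pow_sub_mem hp hx hy (n + 1)))

end Filt

/-! ### The derivative of the exponential -/

section Deriv

variable {R : Type*} [Ring R] [Algebra ℂ R]

/-- The iterated commutators `[…[[w, z], z], …, z]`. -/
def iterComm (z w : R) : ℕ → R
  | 0 => w
  | k + 1 => iterComm z w k * z - z * iterComm z w k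

theorem leibniz_pow (D : R →ₗ[ℂ] R) (hD : ∀ x y, D (x * y) = D x * y + x * D y) (z : R) (n : ℕ) :
    D (z ^ (n + 1)) = ∑ k ∈ Finset.range (n + 1),
      ((n + 1).choose (k + 1) : ℂ) • (z ^ (n - k) * iterComm z (D z) k) := by
  induction n with
  | zero => simp [iterComm]
  | succ n ih =>
    rw [pow_succ, hD, ih, Finset.sum_mul]
    have h1 : ∀ k ∈ Finset.range (n + 1),
        (((n + 1).choose (k + 1) : ℂ) • (z ^ (n - k) * iterComm z (D z) k)) * z
        = ((n + 1).choose (k + 1) : ℂ) • (z ^ (n + 1 - k) * iterComm z (D z) k)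
          + ((n + 1).choose (k + 1) : ℂ) • (z ^ (n - k) * iterComm z (D z) (k + 1)) := by
      intro k hk
      rw [Finset.mem_range] at hk
      rw [smul_mul_assoc, ← smul_add]
      congr 1
      rw [show n + 1 - k = (n - k) + 1 by omega, pow_succ]
      simp only [iterComm]
      noncomm_ring
    rw [Finset.sum_congr rfl h1, Finset.sum_add_distrib]
    rw [Finset.sum_range_succ' _ (n + 1)]
    have h2 : ∀ k ∈ Finset.range (n + 1),
        ((n + 1 + 1).choose (k + 1 + 1) : ℂ) • (z ^ (n + 1 - (k + 1)) * iterComm z (D z) (k + 1))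
        = ((n + 1).choose (k + 1 + 1) : ℂ) • (z ^ (n + 1 - (k + 1)) * iterComm z (D z) (k + 1))
          + ((n + 1).choose (k + 1) : ℂ) • (z ^ (n - k) * iterComm z (D z) (k + 1)) := by
      intro k _
      rw [Nat.choose_succ_succ (n + 1) (k + 1), show n + 1 - (k + 1) = n - k by omega, ← add_smul]
      push_cast
      rw [add_comm]
    rw [Finset.sum_congr rfl h2, Finset.sum_add_distrib]
    have h3 : ∑ k ∈ Finset.range (n + 1),
        ((n + 1).choose (k + 1) : ℂ) • (z ^ (n + 1 - k) * iterComm z (D z) k)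
        = ∑ k ∈ Finset.range (n + 1), ((n + 1).choose (k + 1 + 1) : ℂ) •
            (z ^ (n + 1 - (k + 1)) * iterComm z (D z) (k + 1))
          + ((n + 1).choose (0 + 1) : ℂ) • (z ^ (n + 1 - 0) * iterComm z (D z) 0) := by
      rw [← Finset.sum_range_succ' (fun k => ((n + 1).choose (k + 1) : ℂ) •
        (z ^ (n + 1 - k) * iterComm z (D z) k)) (n + 1), Finset.sum_range_succ _ (n + 1)]
      simp
    rw [h3]
    simp only [zero_add, Nat.choose_one_right, Nat.sub_zero, iterComm]
    push_cast
    rw [add_smul ((n : ℂ) + 1) 1, one_smul]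
    abel

/-- The logarithmic derivative of `exp z`. -/
theorem deriv_nilExp {F : ℕ → Submodule ℂ R} {K : ℕ} (hF : Filt F K)
    (D : R →ₗ[ℂ] R) (hD : ∀ x y, D (x * y) = D x * y + x * D y) {z : R} (hz : z ∈ F 1)
    (hDz : D z ∈ F 1) :
    D (nilExp z) = nilExp z *
      ∑ k ∈ Finset.range K, (((k + 1).factorial : ℂ)⁻¹) • iterComm z (D z) k := by
  have hT : ∀ k, iterComm z (D z) k ∈ F (k + 1) := by
    intro k
    induction k with
    | zero => exact hDz
    | succ k ih => exact (F _).sub_mem (hF.mul_mem ih hz) (hF.mul_mem_le hz ih (by omega))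
  have hD1 : D 1 = 0 := by have := hD 1 1; simpa using this
  obtain ⟨k₀, hk⟩ : ∃ k, K = k + 1 := ⟨K - 1, by have := hF.two_le; omega⟩
  have hzK : z ^ (K + 1) = 0 := by rw [pow_succ, hF.pow_eq_zero hz, zero_mul]
  have e1 : D (nilExp z) = ∑ n ∈ Finset.range K, ∑ k ∈ Finset.range (n + 1),
      (((n - k).factorial : ℂ)⁻¹ * ((k + 1).factorial : ℂ)⁻¹) •
        (z ^ (n - k) * iterComm z (D z) k) := by
    rw [nilExp_eq hzK, map_sum, Finset.sum_range_succ']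
    simp only [pow_zero, map_smul, hD1, smul_zero, add_zero]
    refine Finset.sum_congr rfl fun n _ => ?_
    rw [leibniz_pow D hD, Finset.smul_sum]
    refine Finset.sum_congr rfl fun k hk => ?_
    rw [Finset.mem_range] at hk
    rw [smul_smul]
    congr 1
    have := Nat.choose_mul_factorial_mul_factorial (show k + 1 ≤ n + 1 by omega)
    rw [show n + 1 - (k + 1) = n - k by omega] at this
    have h' : ((n + 1).factorial : ℂ)
        = ((n + 1).choose (k + 1) : ℂ) * ((k + 1).factorial : ℂ) * ((n - k).factorial : ℂ) := by
      exact_mod_cast this.symm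
    have a1 : ((n + 1).factorial : ℂ) ≠ 0 := by exact_mod_cast (Nat.factorial_ne_zero _)
    have a2 : ((k + 1).factorial : ℂ) ≠ 0 := by exact_mod_cast (Nat.factorial_ne_zero _)
    have a3 : ((n - k).factorial : ℂ) ≠ 0 := by exact_mod_cast (Nat.factorial_ne_zero _)
    field_simp
    rw [h']; ring
  have e2 : nilExp z * ∑ k ∈ Finset.range K, (((k + 1).factorial : ℂ)⁻¹) • iterComm z (D z) k
      = ∑ k ∈ Finset.range K, ∑ m ∈ Finset.range K,
        ((m.factorial : ℂ)⁻¹ * ((k + 1).factorial : ℂ)⁻¹) • (z ^ m * iterComm z (D z) k) := by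
    rw [nilExp_eq (hF.pow_eq_zero hz), Finset.sum_mul_sum, Finset.sum_comm]
    refine Finset.sum_congr rfl fun k _ => Finset.sum_congr rfl fun m _ => ?_
    rw [smul_mul_smul_comm]
  rw [e1, e2]
  have e3 : ∀ n ∈ Finset.range K, ∑ k ∈ Finset.range (n + 1),
      (((n - k).factorial : ℂ)⁻¹ * ((k + 1).factorial : ℂ)⁻¹) •
        (z ^ (n - k) * iterComm z (D z) k)
      = ∑ x ∈ Finset.HasAntidiagonal.antidiagonal n, ((x.2.factorial : ℂ)⁻¹ * ((x.1 + 1).factorial : ℂ)⁻¹) •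
        (z ^ x.2 * iterComm z (D z) x.1) := by
    intro n _
    rw [Finset.Nat.sum_antidiagonal_eq_sum_range_succ_mk]
  rw [Finset.sum_congr rfl e3, Finset.sum_sigma', ← Finset.sum_product']
  refine Finset.sum_of_injOn (fun x => x.2) ?_ ?_ ?_ ?_
  · rintro ⟨n, a, b⟩ h ⟨n', a', b'⟩ h' hh
    simp at h h' hh
    obtain ⟨rfl, rfl⟩ := hh
    obtain ⟨-, rfl⟩ := h
    obtain ⟨-, rfl⟩ := h'
    rfl
  · rintro ⟨n, a, b⟩ h
    simp at h ⊢
    omega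
  · rintro ⟨a, b⟩ h h'
    simp at h h'
    have : K ≤ b + (a + 1) := by omega
    rw [hF.eq_zero (hF.mul_mem_le (hF.pow_mem hz b) (hT a) this), smul_zero]
  · rintro ⟨n, a, b⟩ h
    rfl

end Deriv


/-! ### The Campbell–Hausdorff theorem -/

section CH

variable {R : Type*} [Ring R] [Algebra ℂ R]

theorem iterComm_mem {L : Submodule ℂ R} (hL : ∀ x ∈ L, ∀ y ∈ L, x * y - y * x ∈ L) {z w : R}
    (hz : z ∈ L) (hw : w ∈ L) (k : ℕ) : iterComm z w k ∈ L := by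
  induction k with
  | zero => exact hw
  | succ k ih => exact hL _ ih _ hz

theorem conj_nilExp_mem {F : ℕ → Submodule ℂ R} {K : ℕ} (hF : Filt F K) {L : Submodule ℂ R}
    (hL : ∀ x ∈ L, ∀ y ∈ L, x * y - y * x ∈ L) (hLF : L ≤ F 1) {z x : R} (hz : z ∈ L)
    (hx : x ∈ L) : nilExp (-z) * x * nilExp z ∈ L := by
  let D : R →ₗ[ℂ] R := LinearMap.mulRight ℂ x - LinearMap.mulLeft ℂ x
  have hDx : ∀ y, D y = y * x - x * y := fun y => rfl
  have hDz : D z ∈ L := hL _ hz _ hx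
  have h := deriv_nilExp hF D (fun u v => by simp only [hDx]; noncomm_ring) (hLF hz) (hLF hDz)
  rw [hDx] at h
  have h0 := nilExp_neg_mul (hF.isNilpotent (hLF hz))
  have h2 : nilExp (-z) * x * nilExp z
      = x - ∑ k ∈ Finset.range K, (((k + 1).factorial : ℂ)⁻¹) • iterComm z (D z) k := by
    have : x * nilExp z = nilExp z * (x - ∑ k ∈ Finset.range K,
        (((k + 1).factorial : ℂ)⁻¹) • iterComm z (D z) k) := by
      rw [mul_sub, ← h]; abel
    rw [mul_assoc, this, ← mul_assoc, h0, one_mul]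
  rw [h2]
  exact L.sub_mem hx (Submodule.sum_mem _ fun k _ => L.smul_mem _ (iterComm_mem hL hz hDz k))

/-- The polynomials all of whose coefficients lie in a given subspace. -/
def coeffIn (W : Submodule ℂ R) : Submodule ℂ R[X] where
  carrier := {p | ∀ n, p.coeff n ∈ W}
  add_mem' hp hq n := by rw [coeff_add]; exact W.add_mem (hp n) (hq n)
  zero_mem' n := by simp
  smul_mem' c p hp n := by rw [coeff_smul]; exact W.smul_mem c (hp n)

theorem coeffIn_C_mul_X {W : Submodule ℂ R} {a : R} (ha : a ∈ W) : C a * X ∈ coeffIn W := by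
  intro n
  rw [coeff_C_mul, coeff_X]
  split_ifs <;> simp [ha]

theorem coeffIn_C {W : Submodule ℂ R} {a : R} (ha : a ∈ W) : C a ∈ coeffIn W := by
  intro n
  rw [coeff_C]
  split_ifs <;> simp [ha]

theorem Filt.coeffIn {F : ℕ → Submodule ℂ R} {K : ℕ} (hF : Filt F K) :
    Filt (fun n => coeffIn (F n)) K where
  two_le := hF.two_le
  anti m n h p hp k := hF.anti h (hp k)
  one_mem := coeffIn_C hF.one_mem
  mul_mem hx hy n := by
    rw [coeff_mul]
    exact Submodule.sum_mem _ fun i _ => hF.mul_mem (hx _) (hy _)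
  eq_zero hx := by
    ext n
    rw [coeff_zero]
    exact hF.eq_zero (hx n)

theorem coeffIn_comm {L : Submodule ℂ R} (hL : ∀ x ∈ L, ∀ y ∈ L, x * y - y * x ∈ L) :
    ∀ p ∈ coeffIn L, ∀ q ∈ coeffIn L, p * q - q * p ∈ coeffIn L := by
  intro p hp q hq n
  rw [coeff_sub, coeff_mul, coeff_mul, ← Finset.Nat.sum_antidiagonal_swap,
    ← Finset.sum_sub_distrib]
  exact Submodule.sum_mem _ fun i _ => hL _ (hp _) _ (hq _)

theorem derivative_mem {W : Submodule ℂ R} {p : R[X]} (hp : p ∈ coeffIn W) :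
    derivative p ∈ coeffIn W := by
  intro n
  rw [coeff_derivative]
  have : p.coeff (n + 1) * ((n : R) + 1) = ((n : ℂ) + 1) • p.coeff (n + 1) := by
    rw [Algebra.smul_def, Algebra.commutes]; simp
  rw [this]
  exact W.smul_mem _ (hp _)

theorem mem_of_derivative_mem {W : Submodule ℂ R} {p : R[X]} (h0 : p.coeff 0 = 0)
    (hp : derivative p ∈ coeffIn W) : p ∈ coeffIn W := by
  intro n
  cases n with
  | zero => simp [h0]
  | succ n =>
    have h := hp n
    rw [coeff_derivative] at h
    have h1 : p.coeff (n + 1) * ((n : R) + 1) = ((n : ℂ) + 1) • p.coeff (n + 1) := by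
      rw [Algebra.smul_def, Algebra.commutes]; simp
    rw [h1] at h
    have h2 := W.smul_mem ((n : ℂ) + 1)⁻¹ h
    rwa [smul_smul, inv_mul_cancel₀ (by exact_mod_cast Nat.succ_ne_zero n), one_smul] at h2

theorem exists_antideriv (q : R[X]) : ∃ p : R[X], p.coeff 0 = 0 ∧ derivative p = q := by
  refine ⟨q.sum fun n r => monomial (n + 1) (((n : ℂ) + 1)⁻¹ • r), ?_, ?_⟩
  · rw [Polynomial.sum, finsetSum_coeff]
    exact Finset.sum_eq_zero fun n _ => by rw [coeff_monomial, if_neg (by omega)]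
  · rw [Polynomial.sum, map_sum]
    conv_rhs => rw [← Polynomial.sum_monomial_eq q, Polynomial.sum]
    refine Finset.sum_congr rfl fun n _ => ?_
    rw [derivative_monomial]
    congr 1
    have : (((n : ℂ) + 1)⁻¹ • q.coeff n) * ((n + 1 : ℕ) : R)
        = ((n : ℂ) + 1) • ((n : ℂ) + 1)⁻¹ • q.coeff n := by
      rw [Algebra.smul_def ((n : ℂ) + 1), Algebra.commutes]; simp
    rw [this, smul_smul, mul_inv_cancel₀ (by exact_mod_cast Nat.succ_ne_zero n), one_smul]

/-- In a Lie algebra of operators that strictly raise a finite filtration, the product of two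
exponentials is again an exponential. -/
theorem campbell_hausdorff {F : ℕ → Submodule ℂ R} {K : ℕ} (hF : Filt F K) {L : Submodule ℂ R}
    (hL : ∀ x ∈ L, ∀ y ∈ L, x * y - y * x ∈ L) (hLF : L ≤ F 1) {a b : R} (ha : a ∈ L)
    (hb : b ∈ L) : ∃ c ∈ L, nilExp c = nilExp a * nilExp b := by
  have hG := hF.coeffIn
  have hLX := coeffIn_comm hL
  have hLG : coeffIn L ≤ coeffIn (F 1) := fun p hp n => hLF (hp n)
  let D : R[X] →ₗ[ℂ] R[X] :=
    { toFun := derivative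
      map_add' := fun p q => derivative_add
      map_smul' := fun c p => derivative_smul c p }
  have hDd : ∀ p, D p = derivative p := fun _ => rfl
  have hD : ∀ p q, D (p * q) = D p * q + p * D q := fun p q => derivative_mul
  have hlin : ∀ x ∈ L, D (nilExp (C x * X)) = C x * nilExp (C x * X) ∧
      D (nilExp (C x * X)) = nilExp (C x * X) * C x := by
    intro x hx
    have hDx : D (C x * X) = C x := by rw [hDd, derivative_C_mul, derivative_X, mul_one]
    have hcomm : Commute (C x : R[X]) (C x * X) :=
      (Commute.refl _).mul_right (commute_X _).symm
    have hc2 : Commute (C x : R[X]) (nilExp (C x * X)) :=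
      Commute.sum_right _ _ _ fun n _ => (hcomm.pow_right n).smul_right _
    have h := deriv_nilExp hG D hD (hLG (coeffIn_C_mul_X hx))
      (by rw [hDx]; exact hLG (coeffIn_C hx))
    have hit : ∀ k, iterComm (C x * X) (D (C x * X)) (k + 1) = 0 := by
      intro k
      induction k with
      | zero =>
        simp only [iterComm]
        rw [hDx, hcomm.eq, sub_self]
      | succ k ih => rw [iterComm, ih]; simp
    obtain ⟨k₀, hk⟩ : ∃ k, K = k + 1 := ⟨K - 1, by have := hF.two_le; omega⟩
    rw [hk, Finset.sum_range_succ'] at h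
    simp only [hit, smul_zero, Finset.sum_const_zero, zero_add] at h
    simp only [iterComm, hDx, Nat.factorial_one, Nat.cast_one, inv_one, one_smul] at h
    exact ⟨h.trans hc2.eq.symm, h⟩
  set u : R[X] := nilExp (C a * X) * nilExp (C b * X) with hu
  have hDu : D u = C a * u + u * C b := by
    rw [hu, hD, (hlin a ha).1, (hlin b hb).2]; noncomm_ring
  have hco : ∀ p ∈ coeffIn L, p.coeff 0 = 0 → (nilExp p).coeff 0 = 1 := by
    intro p hp h0
    have hp' := hG.pow_eq_zero (hLG hp)
    obtain ⟨k₀, hk⟩ : ∃ k, K = k + 1 := ⟨K - 1, by have := hF.two_le; omega⟩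
    rw [nilExp_eq hp', hk, Finset.sum_range_succ', coeff_add, finsetSum_coeff]
    rw [Finset.sum_eq_zero]
    · simp
    · intro n _
      rw [coeff_smul, pow_succ, mul_coeff_zero, h0, mul_zero, smul_zero]
  have hu0 : u.coeff 0 = 1 := by
    rw [hu, mul_coeff_zero, hco _ (coeffIn_C_mul_X ha) (by simp),
      hco _ (coeffIn_C_mul_X hb) (by simp), one_mul]
  have main : ∀ p, ∃ c ∈ coeffIn L, c.coeff 0 = 0 ∧ u - nilExp c ∈ coeffIn (F (p + 1)) := by
    intro p
    induction p with
    | zero =>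
      refine ⟨0, (coeffIn L).zero_mem, by simp, ?_⟩
      have h0 : nilExp (0 : R[X]) = 1 := by
        have := hG.two_le
        have h := nilExp_neg_mul (x := (0 : R[X])) IsNilpotent.zero
        rw [nilExp_eq (K := 1) (by simp)]; simp
      have ea := hG.nilExp_sub_one_mem (hLG (coeffIn_C_mul_X ha))
      have eb := hG.nilExp_sub_one_mem (hLG (coeffIn_C_mul_X hb))
      have : u - nilExp 0 = (nilExp (C a * X) - 1) * (nilExp (C b * X) - 1)
          + (nilExp (C a * X) - 1) + (nilExp (C b * X) - 1) := by
        rw [h0, hu]; noncomm_ring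
      rw [this]
      exact Submodule.add_mem _ (Submodule.add_mem _ (hG.mul_mem_le ea eb (by omega)) ea) eb
    | succ p ih =>
      obtain ⟨c, hc, hc0, hy⟩ := ih
      have hcF := hLG hc
      have hDc : D c ∈ coeffIn L := derivative_mem hc
      set e := nilExp c with he
      set w := ∑ k ∈ Finset.range K, (((k + 1).factorial : ℂ)⁻¹) • iterComm c (D c) k with hw
      have hwL : w ∈ coeffIn L := Submodule.sum_mem _ fun k _ =>
        Submodule.smul_mem _ _ (iterComm_mem hLX hc hDc k)
      have hDe : D e = e * w := deriv_nilExp hG D hD hcF (hLG hDc)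
      have hee : nilExp (-c) * e = 1 := nilExp_neg_mul (hG.isNilpotent hcF)
      have hee' : e * nilExp (-c) = 1 := nilExp_mul_neg (hG.isNilpotent hcF)
      set ρ := nilExp (-c) * C a * e + C b - w with hρ
      have hρL : ρ ∈ coeffIn L := Submodule.sub_mem _ (Submodule.add_mem _
        (conj_nilExp_mem hG hLX hLG hc (coeffIn_C ha)) (coeffIn_C hb)) hwL
      have haF := hLG (coeffIn_C ha)
      have hbF := hLG (coeffIn_C hb)
      have hDy : D (u - e) = C a * (u - e) + (u - e) * C b + e * ρ := by
        have : e * ρ = C a * e + e * C b - e * w := by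
          rw [hρ, mul_sub, mul_add, ← mul_assoc, ← mul_assoc, hee', one_mul]
        rw [this, map_sub, hDu, hDe]; noncomm_ring
      have hm : C a * (u - e) + (u - e) * C b ∈ coeffIn (F (p + 1 + 1)) :=
        Submodule.add_mem _ (hG.mul_mem_le haF hy (by omega)) (hG.mul_mem_le hy hbF (by omega))
      have heρ : e * ρ ∈ coeffIn (F (p + 1)) := by
        have h1 : D (u - e) ∈ coeffIn (F (p + 1)) := derivative_mem hy
        have h2 := Submodule.sub_mem _ h1 (hG.anti (by omega : p + 1 ≤ p + 1 + 1) hm)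
        rwa [hDy, add_sub_cancel_left] at h2
      have hρF : ρ ∈ coeffIn (F (p + 1)) := by
        have h1 := hG.mul_mem_le (hG.nilExp_mem (Submodule.neg_mem _ hcF)) heρ
          (by omega : p + 1 ≤ 0 + (p + 1))
        rwa [← mul_assoc, hee, one_mul] at h1
      have hdiff : D (u - e) - ρ ∈ coeffIn (F (p + 1 + 1)) := by
        have : D (u - e) - ρ = (C a * (u - e) + (u - e) * C b) + (e - 1) * ρ := by
          rw [hDy]; noncomm_ring
        rw [this]
        exact Submodule.add_mem _ hm
          (hG.mul_mem_le (hG.nilExp_sub_one_mem hcF) hρF (by omega))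
      obtain ⟨ℓ, hℓ0, hDℓ⟩ := exists_antideriv ρ
      have hℓL : ℓ ∈ coeffIn L := mem_of_derivative_mem hℓ0 (by rw [hDℓ]; exact hρL)
      have hℓF : ℓ ∈ coeffIn (F (p + 1)) := mem_of_derivative_mem hℓ0 (by rw [hDℓ]; exact hρF)
      refine ⟨c + ℓ, Submodule.add_mem _ hc hℓL, by simp [hc0, hℓ0], ?_⟩
      have h1 : u - e - ℓ ∈ coeffIn (F (p + 1 + 1)) := by
        refine mem_of_derivative_mem ?_ ?_
        · rw [coeff_sub, coeff_sub, hu0, he, hco c hc hc0, hℓ0]; simp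
        · have : derivative (u - e - ℓ) = D (u - e) - ρ := by
            rw [derivative_sub, hDℓ]; rfl
          rw [this]; exact hdiff
      have h2 := hG.nilExp_add_sub_mem (by omega : 1 ≤ p + 1) hcF hℓF
      have : u - nilExp (c + ℓ) = (u - e - ℓ) - (nilExp (c + ℓ) - nilExp c - ℓ) := by
        rw [he]; abel
      rw [this]
      exact Submodule.sub_mem _ h1 h2
  obtain ⟨c, hc, -, hcu⟩ := main K
  have hcu' : u = nilExp c := sub_eq_zero.1 (hG.eq_zero (hG.anti (Nat.le_succ K) hcu))
  let φ : R[X] →+* R := eval₂RingHom' (RingHom.id R) 1 fun r => Commute.one_right r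
  have hφs : ∀ (z : ℂ) (p : R[X]), φ (z • p) = z • φ p := by
    intro z p
    have h1 : z • p = C (algebraMap ℂ R z) * p := by
      ext n; simp [Algebra.smul_def]
    have h2 : φ (C (algebraMap ℂ R z)) = algebraMap ℂ R z := by simp [φ]
    rw [h1, map_mul, h2, Algebra.smul_def]
  have hφe : ∀ p ∈ coeffIn L, φ (nilExp p) = nilExp (φ p) := by
    intro p hp
    have h1 := hG.pow_eq_zero (hLG hp)
    have h2 : φ p ^ K = 0 := by rw [← map_pow, h1, map_zero]
    rw [nilExp_eq h1, nilExp_eq h2, map_sum]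
    exact Finset.sum_congr rfl fun n _ => by rw [hφs, map_pow]
  refine ⟨φ c, ?_, ?_⟩
  · have : φ c = ∑ n ∈ c.support, c.coeff n := by
      simp [φ, eval₂_eq_sum, Polynomial.sum]
    rw [this]
    exact Submodule.sum_mem _ fun n _ => hc n
  · rw [← hφe c hc, ← hcu', hu, map_mul, hφe _ (coeffIn_C_mul_X ha), hφe _ (coeffIn_C_mul_X hb)]
    simp [φ]

end CH

end SuperSlodowy

namespace SuperSlodowy

open CategoryTheory TensorProduct


/-! ### Commutative superalgebras -/

/-- The sign `(-1)^(i j)` for parities `i` and `j`. -/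
def sgn (i j : ZMod 2) : ℂ := (-1) ^ (i.val * j.val)

/-- A commutative superalgebra over `ℂ`: an associative unital algebra `A = A₀ ⊕ A₁` graded by
`ℤ/2` such that `a b = (-1)^(|a| |b|) b a` for homogeneous `a`, `b`. -/
structure CommSuperAlg : Type (u + 1) where
  carrier : Type u
  [ring : Ring carrier]
  [algebra : Algebra ℂ carrier]
  par : ZMod 2 → Submodule ℂ carrier
  isCompl : IsCompl (par 0) (par 1)
  one_mem : 1 ∈ par 0
  mul_mem : ∀ {i j a b}, a ∈ par i → b ∈ par j → a * b ∈ par (i + j)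
  comm : ∀ {i j a b}, a ∈ par i → b ∈ par j → a * b = sgn i j • (b * a)

attribute [instance] CommSuperAlg.ring CommSuperAlg.algebra

instance : CoeSort CommSuperAlg.{u} (Type u) := ⟨CommSuperAlg.carrier⟩

/-- Morphisms of commutative superalgebras: parity-preserving algebra homomorphisms. -/
@[ext]
structure CommSuperAlg.Hom (A B : CommSuperAlg.{u}) where
  toAlgHom : A →ₐ[ℂ] B
  map_par : ∀ i, ∀ a ∈ A.par i, toAlgHom a ∈ B.par i

instance : Category CommSuperAlg.{u} where
  Hom := CommSuperAlg.Hom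
  id A := ⟨AlgHom.id ℂ A, fun _ _ h => h⟩
  comp φ ψ := ⟨ψ.toAlgHom.comp φ.toAlgHom, fun i a h => ψ.map_par i _ (φ.map_par i a h)⟩

/-- A functor of points on commutative superalgebras is an affine supervariety if it is
`A ↦ Hom(R, A)` for a finitely generated commutative superalgebra `R` (its coordinate ring). -/
def IsAffineSupervariety (X : CommSuperAlg.{u} ⥤ Type u) : Prop :=
  ∃ R : CommSuperAlg.{u}, Algebra.FiniteType ℂ R ∧ Nonempty (X.CorepresentableBy R)

/-! ### Lie superalgebras -/

/-- A Lie superalgebra over `ℂ`. -/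
class LieSuperalgebra (𝔤 : Type u) [AddCommGroup 𝔤] [Module ℂ 𝔤] where
  par : ZMod 2 → Submodule ℂ 𝔤
  isCompl : IsCompl (par 0) (par 1)
  br : 𝔤 →ₗ[ℂ] 𝔤 →ₗ[ℂ] 𝔤
  br_mem : ∀ {i j x y}, x ∈ par i → y ∈ par j → br x y ∈ par (i + j)
  skew : ∀ {i j x y}, x ∈ par i → y ∈ par j → br x y = -(sgn i j • br y x)
  jacobi : ∀ {i j k x y z}, x ∈ par i → y ∈ par j → z ∈ par k →
    br x (br y z) = br (br x y) z + sgn i j • br y (br x z)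

open LieSuperalgebra

variable {𝔤 : Type u} [AddCommGroup 𝔤] [Module ℂ 𝔤] [LieSuperalgebra 𝔤]

/-- The `A`-points `W(A) = (A ⊗ W)₀ = A₀ ⊗ W₀ ⊕ A₁ ⊗ W₁` of a subspace `W = W₀ ⊕ W₁` of `𝔤`,
as a subspace of `A ⊗ 𝔤`. -/
def pts (W : Submodule ℂ 𝔤) (A : CommSuperAlg.{u}) : Submodule ℂ (A ⊗[ℂ] 𝔤) :=
  Submodule.span ℂ {t | ∃ i, ∃ a ∈ A.par i, ∃ x ∈ W ⊓ par i, t = a ⊗ₜ[ℂ] x}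

/-- The `A`-points `𝔤(A) = (A ⊗ 𝔤)₀` of `𝔤`. -/
abbrev GPts (𝔤 : Type u) [AddCommGroup 𝔤] [Module ℂ 𝔤] [LieSuperalgebra 𝔤]
    (A : CommSuperAlg.{u}) : Type u :=
  ↥(pts (⊤ : Submodule ℂ 𝔤) A)

/-- The `A`-points `W(A)`, as a subspace of `𝔤(A)`. -/
def subPts (W : Submodule ℂ 𝔤) (A : CommSuperAlg.{u}) : Submodule ℂ (GPts 𝔤 A) :=
  (pts W A).comap (pts ⊤ A).subtype

theorem tmul_mem_pts {W : Submodule ℂ 𝔤} {A : CommSuperAlg.{u}} {i : ZMod 2} {a : A} {x : 𝔤}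
    (ha : a ∈ A.par i) (hxW : x ∈ W) (hx : x ∈ par i) : a ⊗ₜ[ℂ] x ∈ pts W A :=
  Submodule.subset_span ⟨i, a, ha, x, ⟨hxW, hx⟩, rfl⟩

theorem pts_mono {W W' : Submodule ℂ 𝔤} (h : W ≤ W') (A : CommSuperAlg.{u}) :
    pts W A ≤ pts W' A :=
  Submodule.span_mono fun _ ⟨i, a, ha, x, hx, ht⟩ => ⟨i, a, ha, x, ⟨h hx.1, hx.2⟩, ht⟩

theorem pts_induction {W : Submodule ℂ 𝔤} {A : CommSuperAlg.{u}} {p : A ⊗[ℂ] 𝔤 → Prop}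
    (h0 : p 0) (hadd : ∀ s t, p s → p t → p (s + t)) (hsmul : ∀ (c : ℂ) t, p t → p (c • t))
    (ht : ∀ i, ∀ a ∈ A.par i, ∀ x ∈ W, x ∈ par i → p (a ⊗ₜ[ℂ] x)) :
    ∀ t ∈ pts W A, p t := by
  intro t h
  induction h using Submodule.span_induction with
  | mem t h =>
    obtain ⟨i, a, ha, x, hx, rfl⟩ := h
    exact ht i a ha x hx.1 hx.2
  | zero => exact h0
  | add s t _ _ hs ht => exact hadd s t hs ht
  | smul c t _ ih => exact hsmul c t ih

/-- The bilinear operation `(a ⊗ x, b ⊗ y) ↦ b a ⊗ [x, y]` on `A ⊗ 𝔤`. On `𝔤(A)`, where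
`|a| = |x|` and `|b| = |y|`, it is the bracket `(-1)^(|x| |b|) a b ⊗ [x, y]` of the sign rule. -/
noncomputable def brA (𝔤 : Type u) [AddCommGroup 𝔤] [Module ℂ 𝔤] [LieSuperalgebra 𝔤]
    (A : CommSuperAlg.{u}) : A ⊗[ℂ] 𝔤 →ₗ[ℂ] A ⊗[ℂ] 𝔤 →ₗ[ℂ] A ⊗[ℂ] 𝔤 :=
  TensorProduct.map₂ (LinearMap.mul ℂ A).flip br

theorem brA_tmul (A : CommSuperAlg.{u}) (a b : A) (x y : 𝔤) :
    brA 𝔤 A (a ⊗ₜ x) (b ⊗ₜ y) = (b * a) ⊗ₜ br x y := by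
  simp [brA]

theorem brA_mem {W W' W'' : Submodule ℂ 𝔤} (h : ∀ x ∈ W, ∀ y ∈ W', br x y ∈ W'')
    {A : CommSuperAlg.{u}} {s t : A ⊗[ℂ] 𝔤} (hs : s ∈ pts W A) (ht : t ∈ pts W' A) :
    brA 𝔤 A s t ∈ pts W'' A := by
  refine pts_induction (p := fun v => brA 𝔤 A v t ∈ pts W'' A) ?_
    (fun s s' h1 h2 => ?_) (fun c s h1 => ?_) ?_ s hs
  · simp
  · rw [map_add, LinearMap.add_apply]; exact Submodule.add_mem _ h1 h2
  · rw [map_smul, LinearMap.smul_apply]; exact Submodule.smul_mem _ _ h1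
  intro i a ha x hxW hx
  refine pts_induction (p := fun v => brA 𝔤 A (a ⊗ₜ x) v ∈ pts W'' A) ?_
    (fun s s' h1 h2 => ?_) (fun c s h1 => ?_) ?_ t ht
  · simp
  · rw [map_add]; exact Submodule.add_mem _ h1 h2
  · rw [map_smul]; exact Submodule.smul_mem _ _ h1
  intro j b hb y hyW hy
  rw [brA_tmul]
  have := A.mul_mem hb ha
  rw [add_comm] at this
  exact tmul_mem_pts this (h x hxW y hyW) (br_mem hx hy)

theorem brA_skew {A : CommSuperAlg.{u}} {s t : A ⊗[ℂ] 𝔤} (hs : s ∈ pts ⊤ A)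
    (ht : t ∈ pts ⊤ A) : brA 𝔤 A s t = -brA 𝔤 A t s := by
  refine pts_induction (p := fun v => brA 𝔤 A v t = -brA 𝔤 A t v) ?_
    (fun s s' h1 h2 => ?_) (fun c s h1 => ?_) ?_ s hs
  · simp
  · simp only [map_add, LinearMap.add_apply, h1, h2]; abel
  · simp only [map_smul, LinearMap.smul_apply, h1, smul_neg]
  intro i a ha x _ hx
  refine pts_induction (p := fun v => brA 𝔤 A (a ⊗ₜ x) v = -brA 𝔤 A v (a ⊗ₜ x)) ?_
    (fun s s' h1 h2 => ?_) (fun c s h1 => ?_) ?_ t ht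
  · simp
  · simp only [map_add, LinearMap.add_apply, h1, h2]; abel
  · simp only [map_smul, LinearMap.smul_apply, h1, smul_neg]
  intro j b hb y _ hy
  rw [brA_tmul, brA_tmul, skew hx hy, A.comm ha hb, TensorProduct.tmul_neg,
    TensorProduct.tmul_smul, TensorProduct.smul_tmul']

theorem brA_jacobi {A : CommSuperAlg.{u}} {r s t : A ⊗[ℂ] 𝔤} (hr : r ∈ pts ⊤ A)
    (hs : s ∈ pts ⊤ A) (ht : t ∈ pts ⊤ A) :
    brA 𝔤 A r (brA 𝔤 A s t) = brA 𝔤 A (brA 𝔤 A r s) t + brA 𝔤 A s (brA 𝔤 A r t) := by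
  refine pts_induction (p := fun v => brA 𝔤 A v (brA 𝔤 A s t) = brA 𝔤 A (brA 𝔤 A v s) t + brA 𝔤 A s (brA 𝔤 A v t)) ?_
    (fun s s' h1 h2 => ?_) (fun c s h1 => ?_) ?_ r hr
  · simp
  · simp only [map_add, LinearMap.add_apply, h1, h2]; abel
  · simp only [map_smul, LinearMap.smul_apply, h1, smul_add]
  intro i a ha x _ hx
  refine pts_induction (p := fun v => brA 𝔤 A (a ⊗ₜ x) (brA 𝔤 A v t) =
      brA 𝔤 A (brA 𝔤 A (a ⊗ₜ x) v) t + brA 𝔤 A v (brA 𝔤 A (a ⊗ₜ x) t)) ?_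
    (fun s s' h1 h2 => ?_) (fun c s h1 => ?_) ?_ s hs
  · simp
  · simp only [map_add, LinearMap.add_apply, h1, h2]; abel
  · simp only [map_smul, LinearMap.smul_apply, h1, smul_add]
  intro j b hb y _ hy
  refine pts_induction (p := fun v => brA 𝔤 A (a ⊗ₜ x) (brA 𝔤 A (b ⊗ₜ y) v) =
      brA 𝔤 A (brA 𝔤 A (a ⊗ₜ x) (b ⊗ₜ y)) v + brA 𝔤 A (b ⊗ₜ y) (brA 𝔤 A (a ⊗ₜ x) v)) ?_
    (fun s s' h1 h2 => ?_) (fun c s h1 => ?_) ?_ t ht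
  · simp
  · simp only [map_add, LinearMap.add_apply, h1, h2]; abel
  · simp only [map_smul, LinearMap.smul_apply, h1, smul_add]
  intro k c hc z _ hz
  simp only [brA_tmul]
  rw [jacobi hx hy hz, TensorProduct.tmul_add, mul_assoc c a b, A.comm ha hb, mul_assoc c b a,
    mul_smul_comm, TensorProduct.tmul_smul, TensorProduct.smul_tmul']

noncomputable instance (A : CommSuperAlg.{u}) : LieRing (GPts 𝔤 A) where
  bracket s t := ⟨brA 𝔤 A s t, brA_mem (fun _ _ _ _ => Submodule.mem_top) s.2 t.2⟩
  add_lie r s t := by ext; simp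
  lie_add r s t := by ext; simp
  lie_self s := by
    ext
    have h := brA_skew s.2 s.2
    have h2 : (2 : ℂ) • brA 𝔤 A s s = 0 := by
      rw [two_smul]; nth_rewrite 1 [h]; exact neg_add_cancel _
    exact (smul_eq_zero.1 h2).resolve_left two_ne_zero
  leibniz_lie r s t := by ext; exact brA_jacobi r.2 s.2 t.2

theorem coe_lie {A : CommSuperAlg.{u}} (s t : GPts 𝔤 A) :
    ((⁅s, t⁆ : GPts 𝔤 A) : A ⊗[ℂ] 𝔤) = brA 𝔤 A s t := rfl

noncomputable instance (A : CommSuperAlg.{u}) : LieAlgebra ℂ (GPts 𝔤 A) where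
  lie_smul c s t := by ext; simp [coe_lie]

/-- The adjoint operators `ad s = [s, -]` of the Lie algebra `𝔤(A)`. -/
noncomputable def ad (A : CommSuperAlg.{u}) : GPts 𝔤 A →ₗ[ℂ] Module.End ℂ (GPts 𝔤 A) :=
  LinearMap.mk₂ ℂ (fun s t => ⁅s, t⁆) add_lie smul_lie lie_add lie_smul

theorem ad_apply {A : CommSuperAlg.{u}} (s t : GPts 𝔤 A) : ad A s t = ⁅s, t⁆ := rfl

/-- The map `W(A) → W(B)` induced by a morphism `A → B`, for `W = 𝔤`. -/
noncomputable def baseChange {A B : CommSuperAlg.{u}} (φ : A ⟶ B) :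
    GPts 𝔤 A →ₗ[ℂ] GPts 𝔤 B :=
  (φ.toAlgHom.toLinearMap.rTensor 𝔤).restrict fun t ht =>
    pts_induction (p := fun t => φ.toAlgHom.toLinearMap.rTensor 𝔤 t ∈ pts ⊤ B) (by simp)
      (fun s s' h1 h2 => by rw [map_add]; exact Submodule.add_mem _ h1 h2)
      (fun c s h1 => by rw [map_smul]; exact Submodule.smul_mem _ _ h1)
      (fun i a ha x hxW hx => tmul_mem_pts (φ.map_par i a ha) hxW hx) t ht

theorem coe_baseChange {A B : CommSuperAlg.{u}} (φ : A ⟶ B) (t : GPts 𝔤 A) :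
    (baseChange φ t : B ⊗[ℂ] 𝔤) = φ.toAlgHom.toLinearMap.rTensor 𝔤 t := rfl

theorem baseChange_mem {W : Submodule ℂ 𝔤} {A B : CommSuperAlg.{u}} (φ : A ⟶ B)
    {t : GPts 𝔤 A} (ht : t ∈ subPts W A) : baseChange φ t ∈ subPts W B :=
  pts_induction (W := W) (p := fun t => φ.toAlgHom.toLinearMap.rTensor 𝔤 t ∈ pts W B) (by simp)
      (fun s s' h1 h2 => by rw [map_add]; exact Submodule.add_mem _ h1 h2)
      (fun c s h1 => by rw [map_smul]; exact Submodule.smul_mem _ _ h1)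
      (fun i a ha x hxW hx => tmul_mem_pts (φ.map_par i a ha) hxW hx) t.1 ht

theorem baseChange_lie {A B : CommSuperAlg.{u}} (φ : A ⟶ B) (s t : GPts 𝔤 A) :
    baseChange φ ⁅s, t⁆ = ⁅baseChange φ s, baseChange φ t⁆ := by
  ext
  simp only [coe_baseChange, coe_lie]
  generalize (s : A ⊗[ℂ] 𝔤) = s
  generalize (t : A ⊗[ℂ] 𝔤) = t
  induction s with
  | zero => simp
  | add s s' h h' => simp [h, h']
  | tmul a x =>
    induction t with
    | zero => simp
    | add s s' h h' => simp [h, h']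
    | tmul b y => simp [brA_tmul]

theorem baseChange_id (A : CommSuperAlg.{u}) (t : GPts 𝔤 A) : baseChange (𝟙 A) t = t := by
  ext
  rw [coe_baseChange]
  change (LinearMap.rTensor 𝔤 LinearMap.id) (t : A ⊗[ℂ] 𝔤) = t
  simp

theorem baseChange_comp {A B C : CommSuperAlg.{u}} (φ : A ⟶ B) (ψ : B ⟶ C) (t : GPts 𝔤 A) :
    baseChange (φ ≫ ψ) t = baseChange ψ (baseChange φ t) := by
  ext
  simp only [coe_baseChange]
  change (LinearMap.rTensor 𝔤 (ψ.toAlgHom.toLinearMap ∘ₗ φ.toAlgHom.toLinearMap)) _ = _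
  rw [LinearMap.rTensor_comp, LinearMap.comp_apply]

/-- The `A`-point of `𝔤` given by an even element `x` of `𝔤`. -/
noncomputable def constPt {x : 𝔤} (hx : x ∈ par (0 : ZMod 2)) (A : CommSuperAlg.{u}) : GPts 𝔤 A :=
  ⟨(1 : A) ⊗ₜ x, tmul_mem_pts A.one_mem trivial hx⟩

theorem baseChange_constPt {A B : CommSuperAlg.{u}} (φ : A ⟶ B) {x : 𝔤}
    (hx : x ∈ par (0 : ZMod 2)) : baseChange φ (constPt hx A) = constPt hx B := by
  ext
  rw [coe_baseChange]
  simp [constPt]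

/-- The affine superspace `x + W ⊆ 𝔤`, through its points `(x + W)(A) = x + W(A) ⊆ 𝔤(A)`. -/
noncomputable def affineSubspace {x : 𝔤} (hx : x ∈ par (0 : ZMod 2)) (W : Submodule ℂ 𝔤) :
    CommSuperAlg.{u} ⥤ Type u where
  obj A := {X : GPts 𝔤 A // X - constPt hx A ∈ subPts W A}
  map φ := ↾fun X => ⟨baseChange φ X.1, by
    rw [← baseChange_constPt φ hx, ← map_sub]
    exact baseChange_mem φ X.2⟩
  map_id A := by
    ext X
    exact congrArg Subtype.val (baseChange_id A X.1)
  map_comp φ ψ := by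
    ext X
    exact congrArg Subtype.val (baseChange_comp φ ψ X.1)

/-! ### Good gradings -/

/-- A `½ℤ`-grading `Γ` of the Lie superalgebra `𝔤` that is good for the even element `f`. The
subspace of degree `n / 2` is `Γ n`. -/
structure IsGoodGrading (Γ : ℤ → Submodule ℂ 𝔤) (f : 𝔤) : Prop where
  isInternal : DirectSum.IsInternal Γ
  par_eq : ∀ i : ZMod 2, par i = ⨆ n, Γ n ⊓ par i
  br_mem : ∀ {m n x y}, x ∈ Γ m → y ∈ Γ n → br x y ∈ Γ (m + n)
  even : f ∈ par (0 : ZMod 2)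
  mem : f ∈ Γ (-2)
  injective : ∀ n, 1 ≤ n → ∀ x ∈ Γ n, br f x = 0 → x = 0
  surjective : ∀ n, n ≤ 1 → ∀ y ∈ Γ (n - 2), ∃ x ∈ Γ n, br f x = y

/-- An `sl₂`-triple in the even part of a Lie superalgebra. -/
structure IsSl2Triple (e h f : 𝔤) : Prop where
  e_even : e ∈ par (0 : ZMod 2)
  h_even : h ∈ par (0 : ZMod 2)
  f_even : f ∈ par (0 : ZMod 2)
  br_e_f : br e f = h
  br_h_e : br h e = (2 : ℂ) • e
  br_h_f : br h f = -((2 : ℂ) • f)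

/-- The subspace `⊕_{m ≥ n} Γ m`, that is, `𝔤_{≥ n/2}`. -/
def geq (Γ : ℤ → Submodule ℂ 𝔤) (n : ℤ) : Submodule ℂ 𝔤 := ⨆ m : {m : ℤ // n ≤ m}, Γ m

theorem le_geq {Γ : ℤ → Submodule ℂ 𝔤} {n m : ℤ} (h : n ≤ m) : Γ m ≤ geq Γ n :=
  le_iSup (fun m : {m : ℤ // n ≤ m} => Γ m) ⟨m, h⟩

theorem geq_anti (Γ : ℤ → Submodule ℂ 𝔤) {n m : ℤ} (h : n ≤ m) : geq Γ m ≤ geq Γ n :=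
  iSup_le fun k => le_geq (h.trans k.2)

/-- The centralizer `𝔤^e`. -/
def centralizer (e : 𝔤) : Submodule ℂ 𝔤 := LinearMap.ker (br e)

section Good

variable {Γ : ℤ → Submodule ℂ 𝔤} {f : 𝔤}

theorem IsGoodGrading.br_geq (hΓ : IsGoodGrading Γ f) {m n : ℤ} :
    ∀ x ∈ geq Γ m, ∀ y ∈ geq Γ n, br x y ∈ geq Γ (m + n) := by
  intro x hx y hy
  induction hx using Submodule.iSup_induction' with
  | mem k x hx =>
    induction hy using Submodule.iSup_induction' with
    | mem l y hy => exact le_geq (add_le_add k.2 l.2) (hΓ.br_mem hx hy)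
    | zero => simp
    | add y y' _ _ h h' => rw [map_add]; exact Submodule.add_mem _ h h'
  | zero => simp
  | add y y' _ _ h h' => rw [map_add, LinearMap.add_apply]; exact Submodule.add_mem _ h h'

theorem IsGoodGrading.exists_bound [FiniteDimensional ℂ 𝔤] (hΓ : IsGoodGrading Γ f) :
    ∃ N : ℕ, geq Γ (-N) = ⊤ ∧ geq Γ (N + 1) = ⊥ := by
  have hfin : {n | Γ n ≠ ⊥}.Finite :=
    WellFoundedGT.finite_ne_bot_of_iSupIndep hΓ.isInternal.submodule_iSupIndep
  obtain ⟨N, hN⟩ : ∃ N : ℕ, ∀ n, Γ n ≠ ⊥ → n.natAbs ≤ N := by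
    obtain ⟨N, hN⟩ := (hfin.image Int.natAbs).bddAbove
    exact ⟨N, fun n hn => hN ⟨n, hn, rfl⟩⟩
  refine ⟨N, ?_, ?_⟩
  · rw [eq_top_iff, ← hΓ.isInternal.submodule_iSup_eq_top]
    refine iSup_le fun n => ?_
    by_cases h : Γ n = ⊥
    · rw [h]; exact bot_le
    · exact le_geq (by have := hN n h; omega)
  · rw [eq_bot_iff]
    refine iSup_le fun n => ?_
    by_contra h
    have h1 : Γ n ≠ ⊥ := fun h' => h (h'.le)
    have h2 := hN n h1
    have h3 := n.2
    omega

/-- Operators on `𝔤(A)` that raise the degree by at least `n / 2`. -/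
def raising (Γ : ℤ → Submodule ℂ 𝔤) (A : CommSuperAlg.{u}) (n : ℕ) :
    Submodule ℂ (Module.End ℂ (GPts 𝔤 A)) where
  carrier := {φ | ∀ m : ℤ, ∀ v ∈ subPts (geq Γ m) A, φ v ∈ subPts (geq Γ (m + n)) A}
  add_mem' h h' m v hv := Submodule.add_mem _ (h m v hv) (h' m v hv)
  zero_mem' _ _ _ := Submodule.zero_mem _
  smul_mem' c _ h m v hv := Submodule.smul_mem _ c (h m v hv)

theorem subPts_mono {W W' : Submodule ℂ 𝔤} (h : W ≤ W') (A : CommSuperAlg.{u}) :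
    subPts W A ≤ subPts W' A :=
  Submodule.comap_mono (pts_mono h A)

theorem mem_subPts_top {A : CommSuperAlg.{u}} (v : GPts 𝔤 A) : v ∈ subPts ⊤ A := v.2

theorem eq_zero_of_mem_subPts_bot {A : CommSuperAlg.{u}} {v : GPts 𝔤 A}
    (h : v ∈ subPts ⊥ A) : v = 0 := by
  ext
  change (v : A ⊗[ℂ] 𝔤) ∈ pts ⊥ A at h
  have : pts (⊥ : Submodule ℂ 𝔤) A ≤ ⊥ := by
    refine Submodule.span_le.2 ?_
    rintro t ⟨i, a, ha, x, hx, rfl⟩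
    have : x = 0 := hx.1
    simp [this]
  exact this h

theorem IsGoodGrading.exists_filt [FiniteDimensional ℂ 𝔤] (hΓ : IsGoodGrading Γ f)
    (A : CommSuperAlg.{u}) : ∃ K, Filt (raising Γ A) K := by
  obtain ⟨N, hN, hN'⟩ := hΓ.exists_bound
  refine ⟨2 * N + 2, by omega, ?_, ?_, ?_, ?_⟩
  · intro n n' h φ hφ m v hv
    exact subPts_mono (geq_anti Γ (by omega)) A (hφ m v hv)
  · intro m v hv
    simpa using hv
  · intro m n φ ψ hφ hψ k v hv
    have := hφ _ _ (hψ k v hv)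
    rw [add_assoc, add_comm (n : ℤ)] at this
    push_cast
    exact this
  · intro φ hφ
    ext1 v
    have h1 : v ∈ subPts (geq Γ (-N)) A := by rw [hN]; exact mem_subPts_top v
    have h2 := hφ _ _ h1
    refine eq_zero_of_mem_subPts_bot (subPts_mono ?_ A h2)
    rw [← hN']
    exact geq_anti Γ (by push_cast; omega)

theorem IsGoodGrading.lie_mem (hΓ : IsGoodGrading Γ f) {A : CommSuperAlg.{u}} {m n : ℤ}
    {s t : GPts 𝔤 A} (hs : s ∈ subPts (geq Γ m) A) (ht : t ∈ subPts (geq Γ n) A) :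
    ⁅s, t⁆ ∈ subPts (geq Γ (m + n)) A :=
  brA_mem hΓ.br_geq hs ht

theorem IsGoodGrading.ad_mem (hΓ : IsGoodGrading Γ f) {A : CommSuperAlg.{u}} {n : ℕ}
    {s : GPts 𝔤 A} (hs : s ∈ subPts (geq Γ n) A) : ad A s ∈ raising Γ A n := by
  intro m v hv
  rw [ad_apply, add_comm]
  exact hΓ.lie_mem hs hv

open Classical in
/-- The projection of `𝔤` onto the subspace of degree `p / 2`. -/
noncomputable def IsGoodGrading.proj (hΓ : IsGoodGrading Γ f) (p : ℤ) : 𝔤 →ₗ[ℂ] 𝔤 :=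
  (Γ p).subtype ∘ₗ DirectSum.component ℂ ℤ (fun n => Γ n) p ∘ₗ
    (LinearEquiv.ofBijective (DirectSum.coeLinearMap Γ) hΓ.isInternal).symm.toLinearMap

theorem IsGoodGrading.proj_of_mem (hΓ : IsGoodGrading Γ f) {p n : ℤ} {x : 𝔤} (hx : x ∈ Γ n) :
    hΓ.proj p x = if n = p then x else 0 := by
  classical
  have h : (LinearEquiv.ofBijective (DirectSum.coeLinearMap Γ) hΓ.isInternal).symm x
      = DirectSum.lof ℂ ℤ (fun n => Γ n) n ⟨x, hx⟩ := by
    rw [LinearEquiv.symm_apply_eq]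
    exact (DirectSum.coeLinearMap_lof (A := Γ) n ⟨x, hx⟩).symm
  unfold IsGoodGrading.proj
  rw [LinearMap.comp_apply, LinearMap.comp_apply, LinearEquiv.coe_coe, h]
  split_ifs with hnp
  · subst hnp
    rw [DirectSum.component.lof_self]; rfl
  · rw [DirectSum.component.of, dif_neg hnp]; rfl

theorem IsGoodGrading.proj_mem (hΓ : IsGoodGrading Γ f) (p : ℤ) (x : 𝔤) : hΓ.proj p x ∈ Γ p :=
  Subtype.coe_prop _

theorem IsGoodGrading.proj_par (hΓ : IsGoodGrading Γ f) (p : ℤ) {i : ZMod 2} {x : 𝔤}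
    (hx : x ∈ par i) : hΓ.proj p x ∈ par i := by
  rw [hΓ.par_eq] at hx
  induction hx using Submodule.iSup_induction' with
  | mem n x hx =>
    rw [hΓ.proj_of_mem hx.1]
    split_ifs
    exacts [hx.2, Submodule.zero_mem _]
  | zero => simp
  | add y y' _ _ h h' => rw [map_add]; exact Submodule.add_mem _ h h'

theorem IsGoodGrading.sub_proj_mem (hΓ : IsGoodGrading Γ f) {p : ℤ} {x : 𝔤}
    (hx : x ∈ geq Γ p) : x - hΓ.proj p x ∈ geq Γ (p + 1) := by
  induction hx using Submodule.iSup_induction' with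
  | mem n x hx =>
    rw [hΓ.proj_of_mem hx]
    split_ifs with h
    · simp
    · rw [sub_zero]
      have := n.2
      exact le_geq (by omega) hx
  | zero => simp
  | add y y' _ _ h h' =>
    rw [map_add, add_sub_add_comm]; exact Submodule.add_mem _ h h'

theorem IsGoodGrading.proj_geq (hΓ : IsGoodGrading Γ f) {p q : ℤ} (hpq : p < q) {x : 𝔤}
    (hx : x ∈ geq Γ q) : hΓ.proj p x = 0 := by
  induction hx using Submodule.iSup_induction' with
  | mem n x hx =>
    rw [hΓ.proj_of_mem hx, if_neg]
    have := n.2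
    omega
  | zero => simp
  | add y y' _ _ h h' => rw [map_add, h, h', add_zero]

theorem IsGoodGrading.proj_br (hΓ : IsGoodGrading Γ f) (p : ℤ) (x : 𝔤) :
    hΓ.proj (p - 2) (br f x) = br f (hΓ.proj p x) := by
  have hx : x ∈ ⨆ n, Γ n := by rw [hΓ.isInternal.submodule_iSup_eq_top]; trivial
  induction hx using Submodule.iSup_induction' with
  | mem n x hx =>
    rw [hΓ.proj_of_mem hx, hΓ.proj_of_mem (hΓ.br_mem hΓ.mem hx)]
    by_cases h : n = p
    · rw [if_pos h, if_pos (by omega)]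
    · rw [if_neg h, if_neg (by omega), map_zero]
  | zero => simp
  | add y y' _ _ h h' => simp only [map_add, h, h']

theorem IsGoodGrading.mem_of_lie_mem (hΓ : IsGoodGrading Γ f) {A : CommSuperAlg.{u}} {p : ℤ}
    (hp : 1 ≤ p) {d : GPts 𝔤 A} (hd : d ∈ subPts (geq Γ p) A)
    (hfd : ⁅constPt hΓ.even A, d⁆ ∈ subPts (geq Γ (p - 1)) A) :
    d ∈ subPts (geq Γ (p + 1)) A := by
  have h1 : ∀ t ∈ pts (geq Γ p) A,
      t - (hΓ.proj p).lTensor A t ∈ pts (geq Γ (p + 1)) A := by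
    refine pts_induction (by simp) (fun s s' h1 h2 => ?_) (fun c s h1 => ?_) ?_
    · rw [map_add, add_sub_add_comm]; exact Submodule.add_mem _ h1 h2
    · rw [map_smul]
      have := Submodule.smul_mem _ c h1
      rwa [smul_sub] at this
    · intro i a ha x hxW hx
      rw [LinearMap.lTensor_tmul, ← TensorProduct.tmul_sub]
      exact tmul_mem_pts ha (hΓ.sub_proj_mem hxW) (Submodule.sub_mem _ hx (hΓ.proj_par p hx))
  have h2 : ∀ t ∈ pts (geq Γ (p - 1)) A, (hΓ.proj (p - 2)).lTensor A t = 0 := by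
    refine pts_induction (by simp) (fun s s' h1 h2 => ?_) (fun c s h1 => ?_) ?_
    · rw [map_add, h1, h2, add_zero]
    · rw [map_smul, h1, smul_zero]
    · intro i a ha x hxW hx
      rw [LinearMap.lTensor_tmul, hΓ.proj_geq (by omega) hxW, TensorProduct.tmul_zero]
  have h3 : ∀ t : A ⊗[ℂ] 𝔤, brA 𝔤 A ((1 : A) ⊗ₜ f) t = (br f).lTensor A t := by
    intro t
    induction t with
    | zero => simp
    | add s s' h h' => rw [map_add, map_add, h, h']
    | tmul a x => rw [brA_tmul, mul_one, LinearMap.lTensor_tmul]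
  have h4 : (hΓ.proj (p - 2)) ∘ₗ br f = br f ∘ₗ hΓ.proj p :=
    LinearMap.ext fun x => hΓ.proj_br p x
  obtain ⟨g, hg⟩ := LinearMap.exists_leftInverse_of_injective (br f ∘ₗ (Γ p).subtype) (by
    rw [LinearMap.ker_eq_bot']
    intro x hx
    exact Subtype.ext (hΓ.injective p hp x x.2 hx))
  have h5 : (Γ p).subtype ∘ₗ g ∘ₗ br f ∘ₗ hΓ.proj p = hΓ.proj p := by
    ext x
    have := LinearMap.congr_fun hg ⟨hΓ.proj p x, hΓ.proj_mem p x⟩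
    exact congrArg Subtype.val this
  have h6 : (hΓ.proj p).lTensor A (d : A ⊗[ℂ] 𝔤) = 0 := by
    have h := h2 _ hfd
    change (hΓ.proj (p - 2)).lTensor A (brA 𝔤 A ((1 : A) ⊗ₜ f) (d : A ⊗[ℂ] 𝔤)) = 0 at h
    rw [h3, ← LinearMap.comp_apply, ← LinearMap.lTensor_comp, h4] at h
    rw [← h5, ← LinearMap.comp_assoc, LinearMap.lTensor_comp, LinearMap.comp_apply, h, map_zero]
  have := h1 _ hd
  change (d : A ⊗[ℂ] 𝔤) - (hΓ.proj p).lTensor A (d : A ⊗[ℂ] 𝔤) ∈ _ at this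
  rwa [h6, sub_zero] at this

end Good

/-! ### The unipotent supergroup -/

section Group

variable [FiniteDimensional ℂ 𝔤] {Γ : ℤ → Submodule ℂ 𝔤} {f : 𝔤}

/-- The adjoint action of `exp Y`, the operator `exp (ad Y)` on `𝔤(A)`. -/
noncomputable def expAd {A : CommSuperAlg.{u}} (Y : GPts 𝔤 A) : Module.End ℂ (GPts 𝔤 A) :=
  nilExp (ad A Y)

theorem IsGoodGrading.expAd_injective (hΓ : IsGoodGrading Γ f) {A : CommSuperAlg.{u}}
    {Y Z : GPts 𝔤 A} (hY : Y ∈ subPts (geq Γ 1) A) (hZ : Z ∈ subPts (geq Γ 1) A)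
    (h : expAd Y (constPt hΓ.even A) = expAd Z (constPt hΓ.even A)) : Y = Z := by
  obtain ⟨K, hF⟩ := hΓ.exists_filt A
  obtain ⟨N, -, hN⟩ := hΓ.exists_bound
  have key : ∀ p : ℕ, Y - Z ∈ subPts (geq Γ (p + 1)) A := by
    intro p
    induction p with
    | zero => simpa using Submodule.sub_mem _ hY hZ
    | succ p ih =>
      have h1 := hF.nilExp_add_sub_mem (by omega : 1 ≤ p + 1)
        (hΓ.ad_mem (n := 1) (by exact_mod_cast hZ)) (hΓ.ad_mem (n := p + 1) (by exact_mod_cast ih))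
      rw [← map_add, add_sub_cancel] at h1
      have hf : constPt hΓ.even A ∈ subPts (geq Γ (-2)) A :=
        tmul_mem_pts A.one_mem (le_geq le_rfl hΓ.mem) hΓ.even
      have h2 := h1 _ _ hf
      have h3 : (nilExp (ad A Y) - nilExp (ad A Z)
          - ad A (Y - Z)) (constPt hΓ.even A)
          = ⁅constPt hΓ.even A, Y - Z⁆ := by
        rw [LinearMap.sub_apply, LinearMap.sub_apply]
        change expAd Y _ - expAd Z _ - _ = _
        rw [h, sub_self, zero_sub, ad_apply, lie_skew]
      rw [h3] at h2
      have := hΓ.mem_of_lie_mem (by omega) ih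
        (subPts_mono (geq_anti Γ (by push_cast; omega)) A h2)
      push_cast
      exact this
  have := key N
  rw [hN] at this
  exact sub_eq_zero.1 (eq_zero_of_mem_subPts_bot this)

theorem IsGoodGrading.exists_expAd_mul (hΓ : IsGoodGrading Γ f) {A : CommSuperAlg.{u}}
    {Y Z : GPts 𝔤 A} (hY : Y ∈ subPts (geq Γ 1) A) (hZ : Z ∈ subPts (geq Γ 1) A) :
    ∃ V ∈ subPts (geq Γ 1) A, expAd V = expAd Y * expAd Z := by
  obtain ⟨K, hF⟩ := hΓ.exists_filt A
  obtain ⟨c, ⟨V, hV, rfl⟩, hc⟩ := campbell_hausdorff hF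
    (L := (subPts (geq Γ 1) A).map (ad A))
    (by
      rintro _ ⟨s, hs, rfl⟩ _ ⟨t, ht, rfl⟩
      refine ⟨⁅s, t⁆, subPts_mono (geq_anti Γ (by omega)) A (hΓ.lie_mem hs ht), ?_⟩
      ext1 v
      rw [LinearMap.sub_apply, Module.End.mul_apply, Module.End.mul_apply]
      simp only [ad_apply, lie_lie])
    (by
      rintro _ ⟨s, hs, rfl⟩
      exact hΓ.ad_mem (n := 1) (by exact_mod_cast hs))
    ⟨Y, hY, rfl⟩ ⟨Z, hZ, rfl⟩
  exact ⟨V, hV, hc⟩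

/-- The `A`-points of the unipotent supergroup `G₊` with Lie superalgebra `𝔤₊ = 𝔤_{>0}`: the
elements `exp Y` for `Y` in `𝔤₊(A)`. -/
@[ext]
structure GPlus (hΓ : IsGoodGrading Γ f) (A : CommSuperAlg.{u}) where
  /-- The element `Y` with `exp Y` the given point. -/
  log : GPts 𝔤 A
  log_mem : log ∈ subPts (geq Γ 1) A

namespace GPlus

variable {hΓ : IsGoodGrading Γ f} {A B : CommSuperAlg.{u}}

/-- The group law of `G₊` (the Campbell–Hausdorff product): `exp Y * exp Z = exp V` for the unique
`V` in `𝔤₊(A)` with `exp (ad V) = exp (ad Y) exp (ad Z)`. Here `ad` is faithful on `𝔤₊`, as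
`ad f` is injective there. -/
noncomputable instance : Mul (GPlus hΓ A) where
  mul g k := ⟨(hΓ.exists_expAd_mul g.log_mem k.log_mem).choose,
    (hΓ.exists_expAd_mul g.log_mem k.log_mem).choose_spec.1⟩

instance : One (GPlus hΓ A) := ⟨⟨0, Submodule.zero_mem _⟩⟩

instance : Inv (GPlus hΓ A) := ⟨fun g => ⟨-g.log, Submodule.neg_mem _ g.log_mem⟩⟩

theorem expAd_mul (g k : GPlus hΓ A) : expAd (g * k).log = expAd g.log * expAd k.log :=
  (hΓ.exists_expAd_mul g.log_mem k.log_mem).choose_spec.2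

theorem expAd_one : expAd (1 : GPlus hΓ A).log = 1 := by
  change nilExp (ad A 0) = 1
  rw [map_zero, nilExp_eq (K := 1) (by simp)]
  simp

theorem expAd_inv (g : GPlus hΓ A) : expAd g⁻¹.log * expAd g.log = 1 := by
  obtain ⟨K, hF⟩ := hΓ.exists_filt A
  change nilExp (ad A (-g.log)) * _ = 1
  rw [map_neg]
  exact nilExp_neg_mul (hF.isNilpotent (hΓ.ad_mem (n := 1) (by exact_mod_cast g.log_mem)))

theorem ext_expAd {g k : GPlus hΓ A}
    (h : expAd g.log (constPt hΓ.even A) = expAd k.log (constPt hΓ.even A)) : g = k :=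
  GPlus.ext (hΓ.expAd_injective g.log_mem k.log_mem h)

noncomputable instance : Group (GPlus hΓ A) where
  mul_assoc g k l := ext_expAd (by simp only [expAd_mul, mul_assoc])
  one_mul g := ext_expAd (by rw [expAd_mul, expAd_one, one_mul])
  mul_one g := ext_expAd (by rw [expAd_mul, expAd_one, mul_one])
  inv_mul_cancel g := ext_expAd (by rw [expAd_mul, expAd_inv, expAd_one])

/-- The adjoint representation `g ↦ (X ↦ g X g⁻¹)` of `G₊(A)` on `𝔤(A)`. -/
noncomputable def Ad : GPlus hΓ A →* Module.End ℂ (GPts 𝔤 A) where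
  toFun g := expAd g.log
  map_one' := expAd_one
  map_mul' := expAd_mul

theorem baseChange_expAd (φ : A ⟶ B) (g : GPlus hΓ A) (X : GPts 𝔤 A) :
    baseChange φ (expAd g.log X) = expAd (baseChange φ g.log) (baseChange φ X) := by
  obtain ⟨K, hF⟩ := hΓ.exists_filt A
  obtain ⟨K', hF'⟩ := hΓ.exists_filt B
  have h1 := hF.pow_eq_zero (hΓ.ad_mem (n := 1) (by exact_mod_cast g.log_mem))
  have h2 := hF'.pow_eq_zero
    (hΓ.ad_mem (n := 1) (by exact_mod_cast baseChange_mem φ g.log_mem))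
  have h3 : ∀ n, baseChange φ ((ad A g.log ^ n) X)
      = (ad B (baseChange φ g.log) ^ n) (baseChange φ X) := by
    intro n
    induction n with
    | zero => simp
    | succ n ih =>
      rw [pow_succ', pow_succ', Module.End.mul_apply, Module.End.mul_apply, ad_apply,
        baseChange_lie, ih, ad_apply]
  unfold expAd
  rw [nilExp_eq (K := K + K') (by rw [pow_add, h1, zero_mul]),
    nilExp_eq (K := K + K') (by rw [pow_add, h2, mul_zero])]
  simp only [LinearMap.sum_apply, LinearMap.smul_apply, map_sum, map_smul, h3]

/-- The homomorphism `G₊(A) → G₊(B)` induced by a morphism `A → B`. -/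
noncomputable def map (φ : A ⟶ B) : GPlus hΓ A →* GPlus hΓ B :=
  MonoidHom.mk' (fun g => ⟨baseChange φ g.log, baseChange_mem φ g.log_mem⟩) fun g k => by
    apply ext_expAd
    rw [expAd_mul, Module.End.mul_apply, ← baseChange_constPt φ, ← baseChange_expAd,
      expAd_mul, Module.End.mul_apply, baseChange_expAd, baseChange_expAd]

end GPlus

/-- The unipotent supergroup `G₊`, as a group-valued functor on commutative superalgebras. -/
noncomputable def unipotentSupergroup (hΓ : IsGoodGrading Γ f) : CommSuperAlg.{u} ⥤ GrpCat.{u} where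
  obj A := GrpCat.of (GPlus hΓ A)
  map φ := GrpCat.ofHom (GPlus.map φ)
  map_id A := by
    ext g
    exact congrArg Subtype.val (baseChange_id A g.log)
  map_comp φ ψ := by
    ext g
    exact congrArg Subtype.val (baseChange_comp φ ψ g.log)

end Group

/-- The underlying supervariety of `G₊`, as a functor of points. -/
noncomputable abbrev unipotentVariety [FiniteDimensional ℂ 𝔤] {Γ : ℤ → Submodule ℂ 𝔤} {f : 𝔤}
    (hΓ : IsGoodGrading Γ f) : CommSuperAlg.{u} ⥤ Type u :=
  unipotentSupergroup hΓ ⋙ forget GrpCat.{u}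

/-- The Slodowy slice `S_f = f + 𝔤^e`. -/
noncomputable abbrev slodowySlice {Γ : ℤ → Submodule ℂ 𝔤} {f : 𝔤} (hΓ : IsGoodGrading Γ f)
    (e : 𝔤) : CommSuperAlg.{u} ⥤ Type u :=
  affineSubspace hΓ.even (centralizer e)

/-- The affine superspace `f + 𝔤_{≥ -1/2}`. -/
noncomputable abbrev affineTarget {Γ : ℤ → Submodule ℂ 𝔤} {f : 𝔤} (hΓ : IsGoodGrading Γ f) :
    CommSuperAlg.{u} ⥤ Type u :=
  affineSubspace hΓ.even (geq Γ (-1))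

end SuperSlodowy

/-!
The proof rests on two facts about the decomposition of `𝔤` under the triple `e, h, f`.

* A finite-dimensional representation of `sl₂` is the direct sum of `ker e` and the image of `f`
  (`isCompl_ker_range`). Complete reducibility is not needed: a weight vector in the intersection
  would be a highest weight vector of natural weight in the image of `f`, which is impossible, and
  the dimensions add up because the triple `f, -h, e` satisfies the same relations.
* As the grading is good, this decomposition restricts to `𝔤_{≥ -1/2} = 𝔤^e ⊕ [f, 𝔤₊]` with `ad f`
  injective on `𝔤₊` (`centralizer_le_geq`, `exists_section`). So there is a linear map `T` which
  vanishes on `𝔤^e`, inverts `ad f` on `[f, 𝔤₊]`, raises the degree by `1` and preserves parity.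
  It extends to points with values in any commutative superalgebra `A` (`exists_section_pts`).

For `V` in `𝔤_{≥ (p + 1)/2}(A)` and `W` in `f + 𝔤_{≥ -1/2}(A)` one has
`exp (ad V) W = W - [f, V]` up to degree `≥ p / 2` (`expAd_sub_sub_mem`). Applying `T` shows, by
induction on the degree, that an element of `G₊(A)` moving a point of the slice to a point of the
slice is trivial (`eq_zero_of_expAd_mem_slice`). Choosing `V = T r`, where `r` is the
deviation of `W` from the slice, pushes the deviation into higher and higher degree until it
vanishes (`exists_Ad_mem_slice`). Hence the map on `A`-points is bijective for every `A`, and it is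
natural in `A`, so it is an isomorphism of functors.

All three functors are of the form `A ↦ W(A)`, up to translation or the exponential. In a
homogeneous basis of `W₀ ⊕ W₁` such a functor consists of tuples of even and odd elements of `A`, so
it is corepresented by a polynomial superalgebra. This is constructed as the quotient `FreeSuper` of
a free algebra by the supercommutation relations between the generators, graded by the eigenspaces
of its parity involution.
-/

namespace SuperSlodowy

open CategoryTheory TensorProduct LieSuperalgebra

/-! ### Finite-dimensional representations of `sl₂` -/

section Sl2

variable {V : Type*} [AddCommGroup V] [Module ℂ V] {E F H : Module.End ℂ V}

/-- On a highest weight vector, `E Fᵏ⁺¹` acts as `(k + 1) (l - k) Fᵏ`. -/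
theorem raise_lower_pow (hEF : ∀ x, E (F x) = F (E x) + H x)
    (hHF : ∀ x, H (F x) = F (H x) - (2 : ℂ) • F x) {v : V} {l : ℂ} (hv : E v = 0)
    (hl : H v = l • v) (k : ℕ) :
    H ((F ^ k) v) = (l - 2 * k) • (F ^ k) v ∧
      E ((F ^ (k + 1)) v) = ((k + 1 : ℂ) * (l - k)) • (F ^ k) v := by
  induction k with
  | zero => simp [hEF, hv, hl]
  | succ k ih =>
    have h1 : H ((F ^ (k + 1)) v) = (l - 2 * (k + 1 : ℕ)) • (F ^ (k + 1)) v := by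
      rw [pow_succ', Module.End.mul_apply, hHF, ih.1, map_smul]
      push_cast
      module
    refine ⟨h1, ?_⟩
    rw [pow_succ' F (k + 1), Module.End.mul_apply, hEF, ih.2, h1, map_smul,
      ← Module.End.mul_apply, ← pow_succ']
    push_cast
    module

/-- The weight of a highest weight vector in a representation with `F` nilpotent is a natural
number. -/
theorem exists_nat_weight (hEF : ∀ x, E (F x) = F (E x) + H x)
    (hHF : ∀ x, H (F x) = F (H x) - (2 : ℂ) • F x) (hF : IsNilpotent F) {v : V} {l : ℂ}
    (hv0 : v ≠ 0) (hv : E v = 0) (hl : H v = l • v) : ∃ k : ℕ, l = k := by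
  obtain ⟨n, hn⟩ := hF
  have hex : ∃ n, (F ^ n) v = 0 := ⟨n, by rw [hn]; rfl⟩
  classical
  obtain ⟨k, hk⟩ : ∃ k, Nat.find hex = k + 1 := by
    refine ⟨Nat.find hex - 1, ?_⟩
    have : Nat.find hex ≠ 0 := fun h => hv0 (by simpa [h] using Nat.find_spec hex)
    omega
  have h1 : (F ^ (k + 1)) v = 0 := hk ▸ Nat.find_spec hex
  have h2 : (F ^ k) v ≠ 0 := Nat.find_min hex (by omega)
  have h3 := (raise_lower_pow hEF hHF hv hl k).2
  rw [h1, map_zero, eq_comm, smul_eq_zero, or_iff_left h2, mul_eq_zero,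
    or_iff_right (by exact_mod_cast Nat.succ_ne_zero k), sub_eq_zero] at h3
  exact ⟨k, h3⟩

/-- On a vector killed by `E F`, `F Eᵏ⁺¹` acts as `-(k + 1) Eᵏ (H + k)`. -/
theorem lower_raise_pow (hEF : ∀ x, E (F x) = F (E x) + H x)
    (hHE : ∀ x, H (E x) = E (H x) + (2 : ℂ) • E x) {y : V} (hy : E (F y) = 0) (k : ℕ) :
    F ((E ^ (k + 1)) y) = -((k + 1 : ℂ) • (E ^ k) (H y + (k : ℂ) • y)) := by
  have hH : ∀ (k : ℕ) (x : V), H ((E ^ k) x) = (E ^ k) (H x) + (2 * k : ℂ) • (E ^ k) x := by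
    intro k x
    induction k with
    | zero => simp
    | succ k ih =>
      rw [pow_succ', Module.End.mul_apply, hHE, ih, Module.End.mul_apply, map_add, map_smul]
      push_cast
      module
  have hFE : ∀ x, F (E x) = E (F x) - H x := fun x => by rw [hEF]; abel
  induction k with
  | zero => simp [hFE, hy]
  | succ k ih =>
    rw [pow_succ', Module.End.mul_apply, hFE, ih, hH, map_neg, map_smul, ← Module.End.mul_apply,
      ← pow_succ', map_add, map_smul, map_add, map_smul]
    push_cast
    module

/-- A highest weight vector of natural weight in the image of `F` vanishes: if `E F y = 0` and
`Eᵐ⁺¹ y = 0`, then `Eᵐ (H + m) y = 0`, and `F (H + m) y` is a nonzero multiple of `F y`. -/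
theorem eq_zero_of_highest_weight (hEF : ∀ x, E (F x) = F (E x) + H x)
    (hHE : ∀ x, H (E x) = E (H x) + (2 : ℂ) • E x)
    (hHF : ∀ x, H (F x) = F (H x) - (2 : ℂ) • F x) {l m : ℕ} {y v : V} (hyv : F y = v)
    (hv : E v = 0) (hl : H v = (l : ℂ) • v) (hm : (E ^ m) y = 0) : v = 0 := by
  induction m generalizing y with
  | zero => rw [← hyv, show y = 0 from by simpa using hm, map_zero]
  | succ m ih =>
    have h1 := lower_raise_pow hEF hHE (hyv ▸ hv) m
    rw [hm, map_zero, eq_comm, neg_eq_zero, smul_eq_zero,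
      or_iff_right (by exact_mod_cast Nat.succ_ne_zero m)] at h1
    have hc : (l + 2 + m : ℂ) ≠ 0 := by
      exact_mod_cast (by omega : l + 2 + m ≠ 0)
    refine ih (y := (l + 2 + m : ℂ)⁻¹ • (H y + (m : ℂ) • y)) ?_ (by rw [map_smul, h1, smul_zero])
    have h2 : F (H y) = H v + (2 : ℂ) • v := by rw [← hyv, hHF]; abel
    rw [map_smul, map_add, h2, map_smul, hyv, hl, ← add_smul, ← add_smul, smul_smul,
      inv_mul_cancel₀ hc, one_smul]

theorem disjoint_ker_range [FiniteDimensional ℂ V] (hEF : ∀ x, E (F x) = F (E x) + H x)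
    (hHE : ∀ x, H (E x) = E (H x) + (2 : ℂ) • E x)
    (hHF : ∀ x, H (F x) = F (H x) - (2 : ℂ) • F x) (hE : IsNilpotent E) (hF : IsNilpotent F) :
    Disjoint (LinearMap.ker E) (LinearMap.range F) := by
  rw [disjoint_iff]
  by_contra hne
  set W := LinearMap.ker E ⊓ LinearMap.range F
  have hW : ∀ x ∈ W, H x ∈ W := by
    rintro x ⟨h1, y, rfl⟩
    rw [SetLike.mem_coe, LinearMap.mem_ker] at h1
    refine ⟨?_, H y - (2 : ℂ) • y, ?_⟩
    · have h2 := hHE (F y)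
      rw [h1, map_zero, smul_zero, add_zero] at h2
      exact h2.symm
    · rw [map_sub, map_smul, hHF]
  have : Nontrivial W := Submodule.nontrivial_iff_ne_bot.2 hne
  obtain ⟨c, hc⟩ := Module.End.exists_eigenvalue (H.restrict hW)
  obtain ⟨⟨v, hvE, y, hy⟩, hv⟩ := hc.exists_hasEigenvector
  have hHv : H v = c • v := congrArg Subtype.val hv.apply_eq_smul
  have hv0 : v ≠ 0 := fun h => hv.2 (Subtype.ext h)
  obtain ⟨l, rfl⟩ := exists_nat_weight hEF hHF hF hv0 hvE hHv
  obtain ⟨m, hm⟩ := hE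
  exact hv0 (eq_zero_of_highest_weight hEF hHE hHF (m := m) hy hvE hHv (by rw [hm]; rfl))

/-- A finite-dimensional representation of `sl₂` is the direct sum of its highest weight vectors
and the image of the lowering operator. -/
theorem isCompl_ker_range [FiniteDimensional ℂ V] (hEF : ∀ x, E (F x) = F (E x) + H x)
    (hHE : ∀ x, H (E x) = E (H x) + (2 : ℂ) • E x)
    (hHF : ∀ x, H (F x) = F (H x) - (2 : ℂ) • F x) (hE : IsNilpotent E) (hF : IsNilpotent F) :
    IsCompl (LinearMap.ker E) (LinearMap.range F) := by
  have h1 := disjoint_ker_range hEF hHE hHF hE hF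
  -- the triple `(F, -H, E)` satisfies the same relations
  have h2 := disjoint_ker_range (E := F) (F := E) (H := -H)
    (fun x => by rw [hEF, LinearMap.neg_apply]; abel)
    (fun x => by rw [LinearMap.neg_apply, LinearMap.neg_apply, hHF, map_neg]; abel)
    (fun x => by rw [LinearMap.neg_apply, LinearMap.neg_apply, hHE, map_neg]; abel) hF hE
  -- hence `dim (ker F) ≤ dim (ker E)`, and `ker E` and `range F` have enough room to span `V`
  refine Submodule.isCompl_iff_disjoint _ _ ?_ |>.2 h1
  have h3 := Submodule.finrank_add_finrank_le_of_disjoint h2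
  have h4 := E.finrank_range_add_finrank_ker
  have h5 := F.finrank_range_add_finrank_ker
  omega

end Sl2

/-! ### Parity and degree -/

section Parity

variable {𝔤 : Type u} [AddCommGroup 𝔤] [Module ℂ 𝔤] [LieSuperalgebra 𝔤]

/-- The projection of `𝔤` onto its homogeneous part of parity `i`. -/
noncomputable def parityProj (𝔤 : Type u) [AddCommGroup 𝔤] [Module ℂ 𝔤] [LieSuperalgebra 𝔤]
    (i : ZMod 2) : 𝔤 →ₗ[ℂ] 𝔤 :=
  if i = 0 then (par 0).projection (par 1) isCompl else (par 1).projection (par 0) isCompl.symm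

theorem zmod_two_cases (i : ZMod 2) : i = 0 ∨ i = 1 := by
  fin_cases i
  exacts [.inl rfl, .inr rfl]

theorem parityProj_mem (i : ZMod 2) (x : 𝔤) : parityProj 𝔤 i x ∈ par i := by
  rcases zmod_two_cases i with rfl | rfl
  · exact Submodule.projection_apply_mem _ x
  · exact Submodule.projection_apply_mem _ x

theorem parityProj_of_mem {i j : ZMod 2} {x : 𝔤} (hx : x ∈ par j) :
    parityProj 𝔤 i x = if i = j then x else 0 := by
  rcases zmod_two_cases i with rfl | rfl <;> rcases zmod_two_cases j with rfl | rfl <;>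
    simp [parityProj, hx, Submodule.projection_apply_eq_zero_iff]

theorem parityProj_add (x : 𝔤) : parityProj 𝔤 0 x + parityProj 𝔤 1 x = x := by
  simp [parityProj, Submodule.projection_add_projection_eq_self]

/-- A linear identity on `𝔤` may be checked on homogeneous elements. -/
theorem parity_ext {M : Type*} [AddCommGroup M] [Module ℂ M] {φ ψ : 𝔤 →ₗ[ℂ] M}
    (h : ∀ i, ∀ x ∈ par i, φ x = ψ x) : φ = ψ := by
  ext x
  rw [← parityProj_add x, map_add, map_add, h 0 _ (parityProj_mem 0 x),
    h 1 _ (parityProj_mem 1 x)]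

theorem parityProj_br {u : 𝔤} (hu : u ∈ par (0 : ZMod 2)) (i : ZMod 2) (x : 𝔤) :
    parityProj 𝔤 i (br u x) = br u (parityProj 𝔤 i x) := by
  have : parityProj 𝔤 i ∘ₗ br u = br u ∘ₗ parityProj 𝔤 i := by
    refine parity_ext fun j x hx => ?_
    have h := br_mem hu hx
    rw [zero_add] at h
    rw [LinearMap.comp_apply, LinearMap.comp_apply, parityProj_of_mem h, parityProj_of_mem hx]
    split_ifs <;> simp
  exact LinearMap.congr_fun this x

/-- The Jacobi identity for an even first and second argument has no signs. -/
theorem jacobi_even {u v : 𝔤} (hu : u ∈ par (0 : ZMod 2)) (hv : v ∈ par (0 : ZMod 2)) (x : 𝔤) :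
    br u (br v x) = br (br u v) x + br v (br u x) := by
  have : br u ∘ₗ br v = br (br u v) + br v ∘ₗ br u :=
    parity_ext fun j x hx => by simpa [sgn] using jacobi hu hv hx
  exact LinearMap.congr_fun this x

end Parity

section Degree

variable {𝔤 : Type u} [AddCommGroup 𝔤] [Module ℂ 𝔤] [LieSuperalgebra 𝔤]
  {Γ : ℤ → Submodule ℂ 𝔤} {e f h : 𝔤}

theorem IsGoodGrading.parityProj_mem_degree (hΓ : IsGoodGrading Γ f) (i : ZMod 2) {n : ℤ}
    {x : 𝔤} (hx : x ∈ Γ n) : parityProj 𝔤 i x ∈ Γ n := by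
  have h1 : parityProj 𝔤 i x = hΓ.proj n (parityProj 𝔤 i x) := by
    have h2 : x = hΓ.proj n (parityProj 𝔤 0 x) + hΓ.proj n (parityProj 𝔤 1 x) := by
      rw [← map_add, parityProj_add, hΓ.proj_of_mem hx, if_pos rfl]
    nth_rewrite 1 [h2]
    rw [map_add, parityProj_of_mem (hΓ.proj_par n (parityProj_mem 0 x)),
      parityProj_of_mem (hΓ.proj_par n (parityProj_mem 1 x))]
    rcases zmod_two_cases i with rfl | rfl <;> simp
  rw [h1]
  exact hΓ.proj_mem n _

theorem IsGoodGrading.parityProj_mem_geq (hΓ : IsGoodGrading Γ f) (i : ZMod 2) {n : ℤ}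
    {x : 𝔤} (hx : x ∈ geq Γ n) : parityProj 𝔤 i x ∈ geq Γ n := by
  induction hx using Submodule.iSup_induction' with
  | mem m x hx => exact le_geq m.2 (hΓ.parityProj_mem_degree i hx)
  | zero => simp
  | add y y' _ _ h h' => rw [map_add]; exact Submodule.add_mem _ h h'

/-- An operator shifting the degree commutes with the projections onto the degrees. -/
theorem IsGoodGrading.proj_shift (hΓ : IsGoodGrading Γ f) {φ : 𝔤 →ₗ[ℂ] 𝔤} {d : ℤ}
    (hφ : ∀ n, ∀ x ∈ Γ n, φ x ∈ Γ (n + d)) (n : ℤ) (x : 𝔤) :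
    hΓ.proj (n + d) (φ x) = φ (hΓ.proj n x) := by
  have hx : x ∈ ⨆ n, Γ n := by rw [hΓ.isInternal.submodule_iSup_eq_top]; trivial
  induction hx using Submodule.iSup_induction' with
  | mem m x hx =>
    rw [hΓ.proj_of_mem hx, hΓ.proj_of_mem (hφ m x hx)]
    by_cases h : m = n
    · rw [if_pos h, if_pos (by omega)]
    · rw [if_neg h, if_neg (by omega), map_zero]
  | zero => simp
  | add y y' _ _ h h' => simp only [map_add, h, h']

theorem proj_mem_centralizer (hΓ : IsGoodGrading Γ f) (he : e ∈ Γ 2) {x : 𝔤}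
    (hx : x ∈ centralizer e) (n : ℤ) : hΓ.proj n x ∈ centralizer e := by
  have h1 := hΓ.proj_shift (φ := br e) (d := 2)
    (fun n x hx => by rw [add_comm]; exact hΓ.br_mem he hx) n x
  rw [LinearMap.mem_ker.1 hx, map_zero] at h1
  exact LinearMap.mem_ker.2 h1.symm

theorem IsGoodGrading.isNilpotent_shift [FiniteDimensional ℂ 𝔤] (hΓ : IsGoodGrading Γ f)
    {φ : 𝔤 →ₗ[ℂ] 𝔤} {d : ℤ} (hd : d ≠ 0) (hφ : ∀ n, ∀ x ∈ Γ n, φ x ∈ Γ (n + d)) :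
    IsNilpotent (φ : Module.End ℂ 𝔤) := by
  have hfin : {n | Γ n ≠ ⊥}.Finite :=
    WellFoundedGT.finite_ne_bot_of_iSupIndep hΓ.isInternal.submodule_iSupIndep
  obtain ⟨N, hN⟩ : ∃ N : ℕ, ∀ n, Γ n ≠ ⊥ → n.natAbs ≤ N := by
    obtain ⟨N, hN⟩ := (hfin.image Int.natAbs).bddAbove
    exact ⟨N, fun n hn => hN ⟨n, hn, rfl⟩⟩
  have hpow : ∀ (k : ℕ) n, ∀ x ∈ Γ n, ((φ : Module.End ℂ 𝔤) ^ k) x ∈ Γ (n + k * d) := by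
    intro k n x hx
    induction k with
    | zero => simpa using hx
    | succ k ih =>
      rw [pow_succ', Module.End.mul_apply]
      have := hφ _ _ ih
      rw [add_assoc] at this
      push_cast
      rwa [add_mul, one_mul]
  refine ⟨2 * N + 1, LinearMap.ext fun x => ?_⟩
  have hx : x ∈ ⨆ n, Γ n := by rw [hΓ.isInternal.submodule_iSup_eq_top]; trivial
  induction hx using Submodule.iSup_induction' with
  | mem n x hx =>
    by_cases hn : Γ n = ⊥
    · rw [hn, Submodule.mem_bot] at hx
      rw [hx, map_zero, map_zero]
    · have h1 := hpow (2 * N + 1) n x hx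
      have h2 : Γ (n + (2 * N + 1 : ℕ) * d) = ⊥ := by
        by_contra h
        have h3 := hN _ h
        have h4 := hN _ hn
        have h5 : 2 * N + 1 ≤ (((2 * N + 1 : ℕ) : ℤ) * d).natAbs := by
          rw [Int.natAbs_mul, Int.natAbs_natCast]
          exact Nat.le_mul_of_pos_right _ (Int.natAbs_pos.2 hd)
        omega
      rw [h2, Submodule.mem_bot] at h1
      rw [h1, LinearMap.zero_apply]
  | zero => simp
  | add y y' _ _ h h' => rw [map_add, h, h', map_add]

/-- An element whose components of degree `< q` vanish has degree
`≥ q`. -/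
theorem IsGoodGrading.mem_geq_of_proj [FiniteDimensional ℂ 𝔤] (hΓ : IsGoodGrading Γ f) {q : ℤ}
    {x : 𝔤} (hx : ∀ p < q, hΓ.proj p x = 0) : x ∈ geq Γ q := by
  obtain ⟨N, hN, -⟩ := hΓ.exists_bound
  have key : ∀ k : ℕ, -(N : ℤ) + k ≤ q → x ∈ geq Γ (-N + k) := by
    intro k
    induction k with
    | zero => intro _; simp [hN]
    | succ k ih =>
      intro hk
      have h1 := hΓ.sub_proj_mem (ih (by omega))
      rw [hx _ (by omega), sub_zero] at h1
      exact geq_anti Γ (by push_cast; omega) h1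
  rcases le_total q (-N) with hq | hq
  · refine geq_anti Γ hq ?_
    rw [hN]; trivial
  · have := key (q + N).toNat (by omega)
    exact geq_anti Γ (by omega) this

theorem IsGoodGrading.br_injOn_geq [FiniteDimensional ℂ 𝔤] (hΓ : IsGoodGrading Γ f) {x : 𝔤}
    (hx : x ∈ geq Γ 1) (h : br f x = 0) : x = 0 := by
  obtain ⟨N, -, hN⟩ := hΓ.exists_bound
  have hz : x ∈ geq Γ (N + 1) := hΓ.mem_geq_of_proj fun p _ => by
    by_cases hp : 1 ≤ p
    · refine hΓ.injective p hp _ (hΓ.proj_mem p x) ?_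
      rw [← hΓ.proj_br, h, map_zero]
    · exact hΓ.proj_geq (by omega) hx
  rwa [hN] at hz

end Degree

/-! ### The transversal decomposition `𝔤_{≥ -1/2} = 𝔤^e ⊕ [f, 𝔤₊]` -/

section Transversal

variable {𝔤 : Type u} [AddCommGroup 𝔤] [Module ℂ 𝔤] [LieSuperalgebra 𝔤]
  {Γ : ℤ → Submodule ℂ 𝔤} {e f h : 𝔤} [FiniteDimensional ℂ 𝔤]

theorem isCompl_centralizer (hΓ : IsGoodGrading Γ f) (hsl : IsSl2Triple e h f) (he : e ∈ Γ 2) :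
    IsCompl (centralizer e) (LinearMap.range (br f)) := by
  refine isCompl_ker_range (E := br e) (F := br f) (H := br h) (fun x => ?_) (fun x => ?_)
    (fun x => ?_) (hΓ.isNilpotent_shift (d := 2) (by norm_num) fun n x hx => ?_)
    (hΓ.isNilpotent_shift (d := -2) (by norm_num) fun n x hx => ?_)
  · rw [jacobi_even hsl.e_even hsl.f_even, hsl.br_e_f, add_comm]
  · rw [jacobi_even hsl.h_even hsl.e_even, hsl.br_h_e, map_smul, LinearMap.smul_apply, add_comm]
  · rw [jacobi_even hsl.h_even hsl.f_even, hsl.br_h_f, map_neg, map_smul, LinearMap.neg_apply,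
      LinearMap.smul_apply]
    abel
  · rw [add_comm]; exact hΓ.br_mem he hx
  · rw [add_comm]; exact hΓ.br_mem hΓ.mem hx

/-- The components of degree `< -1/2` are in the image of `ad f`, hence meet `𝔤^e` trivially. -/
theorem centralizer_le_geq (hΓ : IsGoodGrading Γ f) (hsl : IsSl2Triple e h f) (he : e ∈ Γ 2) :
    centralizer e ≤ geq Γ (-1) := by
  intro x hx
  refine hΓ.mem_geq_of_proj fun p hp => ?_
  obtain ⟨y, -, hy⟩ := hΓ.surjective (p + 2) (by omega) (hΓ.proj p x)
    (by rw [add_sub_cancel_right]; exact hΓ.proj_mem p x)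
  exact Submodule.disjoint_def.1 (isCompl_centralizer hΓ hsl he).disjoint _
    (proj_mem_centralizer hΓ he hx p) ⟨y, hy⟩

/-- The decomposition `𝔤 = 𝔤^e ⊕ [f, 𝔤]` is homogeneous. -/
theorem exists_decomposition (hΓ : IsGoodGrading Γ f) (hsl : IsSl2Triple e h f) (he : e ∈ Γ 2)
    {n : ℤ} {x : 𝔤} (hx : x ∈ Γ n) :
    ∃ c ∈ centralizer e, ∃ y ∈ Γ (n + 2), x = c + br f y := by
  have hx' : x ∈ centralizer e ⊔ LinearMap.range (br f) := by
    rw [(isCompl_centralizer hΓ hsl he).sup_eq_top]; trivial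
  obtain ⟨c, hc, _, ⟨y, rfl⟩, hcy⟩ := Submodule.mem_sup.1 hx'
  refine ⟨hΓ.proj n c, proj_mem_centralizer hΓ he hc n, hΓ.proj (n + 2) y,
    hΓ.proj_mem _ y, ?_⟩
  rw [← hΓ.proj_br, add_sub_cancel_right, ← map_add, hcy, hΓ.proj_of_mem hx, if_pos rfl]

/-- There is a linear map inverting `ad f : 𝔤₊ → [f, 𝔤₊]` and vanishing on `𝔤^e`. It raises the
degree by `1` on `𝔤_{≥ -1/2}`, preserves the parity there, and computes the decomposition
`𝔤_{≥ -1/2} = 𝔤^e ⊕ [f, 𝔤₊]`. -/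
theorem exists_section (hΓ : IsGoodGrading Γ f) (hsl : IsSl2Triple e h f) (he : e ∈ Γ 2) :
    ∃ T : 𝔤 →ₗ[ℂ] 𝔤, (∀ x ∈ centralizer e, T x = 0) ∧ (∀ y ∈ geq Γ 1, T (br f y) = y) ∧
      (∀ n, -1 ≤ n → ∀ x ∈ geq Γ n, T x ∈ geq Γ (n + 2)) ∧
      (∀ x ∈ geq Γ (-1), x - br f (T x) ∈ centralizer e) ∧
      (∀ i, ∀ x ∈ geq Γ (-1), x ∈ par i → T x ∈ par i) := by
  have hcompl := isCompl_centralizer hΓ hsl he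
  obtain ⟨g, hg⟩ := LinearMap.exists_leftInverse_of_injective (br f ∘ₗ (geq Γ 1).subtype) (by
    rw [LinearMap.ker_eq_bot']
    exact fun x hx => Subtype.ext (hΓ.br_injOn_geq x.2 hx))
  set T : 𝔤 →ₗ[ℂ] 𝔤 := (geq Γ 1).subtype ∘ₗ g ∘ₗ
    (LinearMap.range (br f)).projection (centralizer e) hcompl.symm with hT
  have h1 : ∀ x ∈ centralizer e, T x = 0 := by
    intro x hx
    rw [hT, LinearMap.comp_apply, LinearMap.comp_apply,
      (Submodule.projection_apply_eq_zero_iff _).2 hx, map_zero, map_zero]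
  have h2 : ∀ y ∈ geq Γ 1, T (br f y) = y := by
    intro y hy
    have h3 : (LinearMap.range (br f)).projection (centralizer e) hcompl.symm (br f y) = br f y :=
      (Submodule.projection_eq_self_iff _ _).2 ⟨y, rfl⟩
    rw [hT, LinearMap.comp_apply, LinearMap.comp_apply, h3]
    exact congrArg Subtype.val (LinearMap.congr_fun hg ⟨y, hy⟩)
  have hhom : ∀ n, -1 ≤ n → ∀ x ∈ Γ n, T x ∈ Γ (n + 2) ∧ x - br f (T x) ∈ centralizer e := by
    intro n hn x hx
    obtain ⟨c, hc, y, hy, rfl⟩ := exists_decomposition hΓ hsl he hx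
    rw [map_add, h1 c hc, zero_add, h2 y (le_geq (by omega) hy), add_sub_cancel_right]
    exact ⟨hy, hc⟩
  have h3 : ∀ n, -1 ≤ n → ∀ x ∈ geq Γ n, T x ∈ geq Γ (n + 2) := by
    intro n hn x hx
    induction hx using Submodule.iSup_induction' with
    | mem m x hx =>
      exact le_geq (by have := m.2; omega) (hhom m (hn.trans m.2) x hx).1
    | zero => simp
    | add y y' _ _ h h' => rw [map_add]; exact Submodule.add_mem _ h h'
  have h4 : ∀ x ∈ geq Γ (-1), x - br f (T x) ∈ centralizer e := by
    intro x hx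
    induction hx using Submodule.iSup_induction' with
    | mem m x hx => exact (hhom m m.2 x hx).2
    | zero => simp
    | add y y' _ _ h h' =>
      rw [map_add, map_add, add_sub_add_comm]; exact Submodule.add_mem _ h h'
  refine ⟨T, h1, h2, h3, h4, fun i x hx hxi => ?_⟩
  -- the decomposition of `x` is unique, and its part of parity `i` is another one
  have hc := h4 x hx
  have hy := h3 (-1) le_rfl x hx
  have h5 : x = parityProj 𝔤 i (x - br f (T x)) + br f (parityProj 𝔤 i (T x)) := by
    rw [← parityProj_br hsl.f_even, ← map_add, sub_add_cancel, parityProj_of_mem hxi, if_pos rfl]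
  have h6 : parityProj 𝔤 i (x - br f (T x)) ∈ centralizer e := by
    refine LinearMap.mem_ker.2 ?_
    rw [← parityProj_br hsl.e_even, LinearMap.mem_ker.1 hc, map_zero]
  rw [h5, map_add, h1 _ h6, zero_add, h2 _ (hΓ.parityProj_mem_geq i hy)]
  exact parityProj_mem i _

end Transversal

/-! ### Transversality on points -/

section Points

variable {𝔤 : Type u} [AddCommGroup 𝔤] [Module ℂ 𝔤] [LieSuperalgebra 𝔤]
  {Γ : ℤ → Submodule ℂ 𝔤} {e f h : 𝔤} {A : CommSuperAlg.{u}}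

theorem lTensor_mem_pts {T : 𝔤 →ₗ[ℂ] 𝔤} {W W' : Submodule ℂ 𝔤}
    (hT : ∀ i, ∀ x ∈ W, x ∈ par i → T x ∈ W' ⊓ par i) {t : A ⊗[ℂ] 𝔤} (ht : t ∈ pts W A) :
    T.lTensor A t ∈ pts W' A := by
  refine pts_induction (p := fun t => T.lTensor A t ∈ pts W' A) (by simp)
    (fun s s' h1 h2 => ?_) (fun c s h1 => ?_) (fun i a ha x hxW hx => ?_) t ht
  · rw [map_add]; exact Submodule.add_mem _ h1 h2
  · rw [map_smul]; exact Submodule.smul_mem _ _ h1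
  · rw [LinearMap.lTensor_tmul]
    exact tmul_mem_pts ha (hT i x hxW hx).1 (hT i x hxW hx).2

theorem lTensor_eq_of_mem_pts {T T' : 𝔤 →ₗ[ℂ] 𝔤} {W : Submodule ℂ 𝔤}
    (hT : ∀ x ∈ W, T x = T' x) {t : A ⊗[ℂ] 𝔤} (ht : t ∈ pts W A) :
    T.lTensor A t = T'.lTensor A t := by
  refine pts_induction (p := fun t => T.lTensor A t = T'.lTensor A t) (by simp)
    (fun s s' h1 h2 => ?_) (fun c s h1 => ?_) (fun i a ha x hxW hx => ?_) t ht
  · rw [map_add, map_add, h1, h2]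
  · rw [map_smul, map_smul, h1]
  · rw [LinearMap.lTensor_tmul, LinearMap.lTensor_tmul, hT x hxW]

theorem coe_constPt_lie {x : 𝔤} (hx : x ∈ par (0 : ZMod 2)) (s : GPts 𝔤 A) :
    ((⁅constPt hx A, s⁆ : GPts 𝔤 A) : A ⊗[ℂ] 𝔤) = (br x).lTensor A s := by
  rw [coe_lie]
  change brA 𝔤 A (1 ⊗ₜ x) s = _
  generalize (s : A ⊗[ℂ] 𝔤) = t
  induction t with
  | zero => simp
  | add s s' h h' => rw [map_add, map_add, h, h']
  | tmul a y => rw [brA_tmul, mul_one, LinearMap.lTensor_tmul]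

theorem constPt_mem (hΓ : IsGoodGrading Γ f) (A : CommSuperAlg.{u}) :
    constPt hΓ.even A ∈ subPts (geq Γ (-2)) A :=
  tmul_mem_pts A.one_mem (le_geq le_rfl hΓ.mem) hΓ.even

variable [FiniteDimensional ℂ 𝔤]

/-- The map of `exists_section` on `A`-points. -/
theorem exists_section_pts (hΓ : IsGoodGrading Γ f) (hsl : IsSl2Triple e h f) (he : e ∈ Γ 2)
    (A : CommSuperAlg.{u}) : ∃ τ : A ⊗[ℂ] 𝔤 →ₗ[ℂ] A ⊗[ℂ] 𝔤,
      (∀ x ∈ pts (centralizer e) A, τ x = 0) ∧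
      (∀ y : GPts 𝔤 A, y ∈ subPts (geq Γ 1) A → τ (⁅constPt hΓ.even A, y⁆ : GPts 𝔤 A) = y) ∧
      (∀ n, -1 ≤ n → ∀ x ∈ pts (geq Γ n) A, τ x ∈ pts (geq Γ (n + 2)) A) ∧
      (∀ x y : GPts 𝔤 A, x ∈ subPts (geq Γ (-1)) A → τ x = y →
        x - ⁅constPt hΓ.even A, y⁆ ∈ subPts (centralizer e) A) := by
  obtain ⟨T, h1, h2, h3, h4, h5⟩ := exists_section hΓ hsl he
  refine ⟨T.lTensor A, fun x hx => ?_, fun y hy => ?_, fun n hn x hx => ?_,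
    fun x y hx hy => ?_⟩
  · rw [lTensor_eq_of_mem_pts (T' := 0) h1 hx, LinearMap.lTensor_zero, LinearMap.zero_apply]
  · rw [coe_constPt_lie, ← LinearMap.comp_apply, ← LinearMap.lTensor_comp,
      lTensor_eq_of_mem_pts (T := T ∘ₗ br f) (T' := LinearMap.id) h2 (t := y.1) hy,
      LinearMap.lTensor_id, LinearMap.id_apply]
  · exact lTensor_mem_pts (fun i x hx hi =>
      ⟨h3 n hn x hx, h5 i x (geq_anti Γ hn hx) hi⟩) hx
  · have h6 := lTensor_mem_pts (T := LinearMap.id - br f ∘ₗ T) (W' := centralizer e)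
      (fun i x hx hi => ⟨h4 x hx, Submodule.sub_mem _ hi
        (by simpa using br_mem hΓ.even (h5 i x hx hi))⟩) hx
    change ((x - ⁅constPt hΓ.even A, y⁆ : GPts 𝔤 A) : A ⊗[ℂ] 𝔤) ∈ pts (centralizer e) A
    rw [LinearMap.lTensor_sub, LinearMap.sub_apply, LinearMap.lTensor_comp, LinearMap.comp_apply,
      LinearMap.lTensor_id, LinearMap.id_apply] at h6
    rw [Submodule.coe_sub, coe_constPt_lie, ← hy]
    exact h6

/-- To first order, `exp (ad V)` is `1 + ad V`. -/
theorem expAd_sub_mem (hΓ : IsGoodGrading Γ f) {p : ℕ} {V : GPts 𝔤 A}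
    (hV : V ∈ subPts (geq Γ (p + 1)) A) {m : ℤ} {W : GPts 𝔤 A} (hW : W ∈ subPts (geq Γ m) A) :
    expAd V W - W - ⁅V, W⁆ ∈ subPts (geq Γ (m + p + 2)) A := by
  obtain ⟨K, hF⟩ := hΓ.exists_filt A
  have h1 := hF.nilExp_add_sub_mem (by omega : 1 ≤ p + 1) (Submodule.zero_mem _)
    (hΓ.ad_mem (n := p + 1) (by exact_mod_cast hV))
  have h0 : nilExp (0 : Module.End ℂ (GPts 𝔤 A)) = 1 := by
    rw [nilExp_eq (K := 1) (by simp)]; simp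
  rw [zero_add, h0] at h1
  have h2 := h1 m W hW
  push_cast at h2
  rwa [add_assoc, one_add_one_eq_two, ← add_assoc] at h2

/-- For `V` of degree `≥ (p + 1) / 2` and `W` in `f + 𝔤_{≥ -1/2}`, `exp (ad V) W` is
`W - [f, V]` up to degree `≥ p / 2`. -/
theorem expAd_sub_sub_mem (hΓ : IsGoodGrading Γ f) {p : ℕ} {V : GPts 𝔤 A}
    (hV : V ∈ subPts (geq Γ (p + 1)) A) {W : GPts 𝔤 A}
    (hW : W - constPt hΓ.even A ∈ subPts (geq Γ (-1)) A) :
    expAd V W - W + ⁅constPt hΓ.even A, V⁆ ∈ subPts (geq Γ p) A := by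
  have hW' : W ∈ subPts (geq Γ (-2)) A := by
    have := Submodule.add_mem _ (subPts_mono (geq_anti Γ (by omega)) A hW) (constPt_mem hΓ A)
    rwa [sub_add_cancel] at this
  have h1 := expAd_sub_mem hΓ hV hW'
  have h2 := hΓ.lie_mem hV hW
  rw [show -2 + (p : ℤ) + 2 = p by ring] at h1
  rw [show (p : ℤ) + 1 + -1 = p by ring] at h2
  have h3 := Submodule.add_mem _ h1 h2
  rw [lie_sub, ← lie_skew V (constPt hΓ.even A)] at h3
  convert h3 using 1
  abel

/-- If `exp V` in `G₊` moves a point of the slice to a point of the slice, then `V = 0`. -/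
theorem eq_zero_of_expAd_mem_slice (hΓ : IsGoodGrading Γ f) (hsl : IsSl2Triple e h f)
    (he : e ∈ Γ 2) {X V : GPts 𝔤 A} (hX : X - constPt hΓ.even A ∈ subPts (centralizer e) A)
    (hV : V ∈ subPts (geq Γ 1) A)
    (hVX : expAd V X - constPt hΓ.even A ∈ subPts (centralizer e) A) : V = 0 := by
  obtain ⟨τ, h1, h2, h3, -⟩ := exists_section_pts hΓ hsl he A
  obtain ⟨N, -, hN⟩ := hΓ.exists_bound
  have key : ∀ p : ℕ, V ∈ subPts (geq Γ (p + 1)) A := by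
    intro p
    induction p with
    | zero => simpa using hV
    | succ p ih =>
      have h4 := expAd_sub_sub_mem hΓ ih
        (subPts_mono (centralizer_le_geq hΓ hsl he) A hX)
      -- `exp (ad V) X - X` is killed by `τ`, and `τ [f, V] = V`
      have h5 := h3 p (by omega) _ h4
      have h6 : τ ((expAd V X - X : GPts 𝔤 A) : A ⊗[ℂ] 𝔤) = 0 := by
        refine h1 _ ?_
        have := Submodule.sub_mem _ hVX hX
        rwa [sub_sub_sub_cancel_right] at this
      rw [map_add, map_add, Submodule.subtype_apply, Submodule.subtype_apply, h6, zero_add,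
        h2 V hV] at h5
      exact subPts_mono (geq_anti Γ (by push_cast; omega)) A h5
  have := key N
  rw [hN] at this
  exact eq_zero_of_mem_subPts_bot this

/-- Every `G₊`-orbit in `f + 𝔤_{≥ -1/2}` meets the slice. -/
theorem exists_Ad_mem_slice (hΓ : IsGoodGrading Γ f) (hsl : IsSl2Triple e h f)
    (he : e ∈ Γ 2) {Z : GPts 𝔤 A} (hZ : Z - constPt hΓ.even A ∈ subPts (geq Γ (-1)) A) :
    ∃ g : GPlus hΓ A, GPlus.Ad g Z - constPt hΓ.even A ∈ subPts (centralizer e) A := by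
  obtain ⟨τ, -, -, h3, h4⟩ := exists_section_pts hΓ hsl he A
  obtain ⟨N, -, hN⟩ := hΓ.exists_bound
  have hle := subPts_mono (centralizer_le_geq hΓ hsl he) A
  -- the error term, transversal to the slice, is moved into higher and higher degree
  have key : ∀ p : ℕ, ∃ g : GPlus hΓ A, ∃ c ∈ subPts (centralizer e) A,
      ∃ r ∈ subPts (geq Γ (p - 1)) A, GPlus.Ad g Z = constPt hΓ.even A + c + r := by
    intro p
    induction p with
    | zero =>
      refine ⟨1, 0, Submodule.zero_mem _, Z - constPt hΓ.even A, by simpa using hZ, ?_⟩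
      rw [map_one, Module.End.one_apply]
      abel
    | succ p ih =>
      obtain ⟨g, c, hc, r, hr, hg⟩ := ih
      have hτ := h3 _ (by omega) _ hr
      rw [show (p : ℤ) - 1 + 2 = p + 1 by ring] at hτ
      set V : GPts 𝔤 A := ⟨τ r, pts_mono le_top A hτ⟩ with hVdef
      have hV : V ∈ subPts (geq Γ (p + 1)) A := hτ
      have hr' : r ∈ subPts (geq Γ (-1)) A := subPts_mono (geq_anti Γ (by omega)) A hr
      have hfV := h4 r V hr' rfl
      have hW : GPlus.Ad g Z - constPt hΓ.even A ∈ subPts (geq Γ (-1)) A := by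
        rw [hg, add_assoc, add_sub_cancel_left]
        exact Submodule.add_mem _ (hle hc) hr'
      refine ⟨⟨V, subPts_mono (geq_anti Γ (by omega)) A hV⟩ * g,
        c + (r - ⁅constPt hΓ.even A, V⁆), Submodule.add_mem _ hc hfV, _,
        by simpa using expAd_sub_sub_mem hΓ hV hW, ?_⟩
      rw [map_mul, Module.End.mul_apply]
      change expAd V _ = _
      nth_rewrite 3 [hg]
      abel
  obtain ⟨g, c, hc, r, hr, hg⟩ := key (N + 2)
  refine ⟨g, ?_⟩
  have hr0 : r = 0 := by
    refine eq_zero_of_mem_subPts_bot (hN ▸ ?_)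
    exact subPts_mono (geq_anti Γ (by push_cast; omega)) A hr
  rw [hg, hr0, add_zero, add_sub_cancel_left]
  exact hc

theorem Ad_mem_target (hΓ : IsGoodGrading Γ f) (g : GPlus hΓ A) {X : GPts 𝔤 A}
    (hX : X - constPt hΓ.even A ∈ subPts (geq Γ (-1)) A) :
    GPlus.Ad g X - constPt hΓ.even A ∈ subPts (geq Γ (-1)) A := by
  have h1 := expAd_sub_sub_mem hΓ (p := 0) (by simpa using g.log_mem) hX
  have h2 := hΓ.lie_mem (constPt_mem hΓ A) g.log_mem
  have h3 := Submodule.add_mem _ (Submodule.sub_mem _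
    (subPts_mono (geq_anti Γ (by norm_num : (-1 : ℤ) ≤ (0 : ℕ))) A h1) h2) hX
  convert h3 using 1
  change expAd g.log X - _ = _
  abel

end Points

/-! ### The conjugation map -/

section Conjugation

variable {𝔤 : Type u} [AddCommGroup 𝔤] [Module ℂ 𝔤] [LieSuperalgebra 𝔤]
  {Γ : ℤ → Submodule ℂ 𝔤} {e f h : 𝔤} [FiniteDimensional ℂ 𝔤]

/-- The morphism `S_f × G₊ → f + 𝔤_{≥ -1/2}`, `(X, g) ↦ g⁻¹ X g`. -/
noncomputable def conjMap (hΓ : IsGoodGrading Γ f) (hsl : IsSl2Triple e h f) (he : e ∈ Γ 2) :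
    FunctorToTypes.prod (slodowySlice.{u} hΓ e) (unipotentVariety hΓ) ⟶ affineTarget hΓ where
  app A := ↾fun (p : (slodowySlice hΓ e).obj A × GPlus hΓ A) => ⟨GPlus.Ad p.2⁻¹ p.1.1,
    Ad_mem_target hΓ p.2⁻¹ (subPts_mono (centralizer_le_geq hΓ hsl he) A p.1.2)⟩
  naturality A B φ := by
    ext p
    obtain ⟨X, (g : GPlus hΓ A)⟩ := p
    refine Subtype.ext ?_
    change GPlus.Ad (GPlus.map φ g)⁻¹ (baseChange φ X.1) = baseChange φ (GPlus.Ad g⁻¹ X.1)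
    rw [← map_inv]
    exact (GPlus.baseChange_expAd φ g⁻¹ X.1).symm

theorem conjMap_bijective (hΓ : IsGoodGrading Γ f) (hsl : IsSl2Triple e h f) (he : e ∈ Γ 2)
    (A : CommSuperAlg.{u}) : Function.Bijective ((conjMap hΓ hsl he).app A) := by
  have hinv : ∀ (g : GPlus hΓ A) Y, GPlus.Ad g (GPlus.Ad g⁻¹ Y) = Y := fun g Y => by
    rw [← Module.End.mul_apply, ← map_mul, mul_inv_cancel, map_one, Module.End.one_apply]
  constructor
  · rintro ⟨X, (g : GPlus hΓ A)⟩ ⟨X', (g' : GPlus hΓ A)⟩ hXX'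
    have h1 : GPlus.Ad g⁻¹ X.1 = GPlus.Ad g'⁻¹ X'.1 := congrArg Subtype.val hXX'
    have h2 : GPlus.Ad (g' * g⁻¹) X.1 = X'.1 := by
      rw [map_mul, Module.End.mul_apply, h1, hinv]
    have h3 : (g' * g⁻¹).log = 0 := eq_zero_of_expAd_mem_slice hΓ hsl he X.2
      (g' * g⁻¹).log_mem (by
        have := X'.2
        rw [← h2] at this
        exact this)
    have h4 : g' * g⁻¹ = 1 := GPlus.ext h3
    rw [h4, map_one, Module.End.one_apply] at h2
    exact Prod.ext (Subtype.ext h2) (mul_inv_eq_one.1 h4).symm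
  · intro Z
    obtain ⟨g, hg⟩ := exists_Ad_mem_slice hΓ hsl he Z.2
    refine ⟨(⟨GPlus.Ad g Z.1, hg⟩, g), Subtype.ext ?_⟩
    change GPlus.Ad g⁻¹ (GPlus.Ad g Z.1) = Z.1
    rw [← Module.End.mul_apply, ← map_mul, inv_mul_cancel, map_one, Module.End.one_apply]

end Conjugation

/-! ### Free commutative superalgebras -/

section FreeSuper

variable {σ : Type u}

theorem sgn_zero_right (i : ZMod 2) : sgn i 0 = 1 := by simp [sgn]

theorem sgn_zero_left (i : ZMod 2) : sgn 0 i = 1 := by simp [sgn]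

theorem sgn_one_one : sgn 1 1 = -1 := by simp [sgn, ZMod.val_one]

theorem sgn_mul_self (i j : ZMod 2) : sgn i j * sgn i j = 1 := by
  unfold sgn
  rw [← pow_add, ← two_mul, pow_mul]
  norm_num

/-- The relations `x y = (-1)^(|x| |y|) y x` between generators `x`, `y` of parities prescribed by
`p`. -/
inductive SuperRel (p : σ → ZMod 2) : FreeAlgebra ℂ σ → FreeAlgebra ℂ σ → Prop
  | comm (x y : σ) : SuperRel p (FreeAlgebra.ι ℂ x * FreeAlgebra.ι ℂ y)
      (sgn (p x) (p y) • (FreeAlgebra.ι ℂ y * FreeAlgebra.ι ℂ x))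

/-- The underlying algebra of the free commutative superalgebra on generators of parities
prescribed by `p`. -/
def FreeSuper (p : σ → ZMod 2) : Type u := RingQuot (SuperRel p)

namespace FreeSuper

variable {p : σ → ZMod 2}

noncomputable instance : Ring (FreeSuper p) := inferInstanceAs (Ring (RingQuot (SuperRel p)))

noncomputable instance : Algebra ℂ (FreeSuper p) :=
  inferInstanceAs (Algebra ℂ (RingQuot (SuperRel p)))

variable (p) in
/-- The quotient map from the free algebra. -/
noncomputable def mk : FreeAlgebra ℂ σ →ₐ[ℂ] FreeSuper p := RingQuot.mkAlgHom ℂ (SuperRel p)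

theorem mk_surjective : Function.Surjective (mk p) :=
  RingQuot.mkAlgHom_surjective ℂ (SuperRel p)

variable (p) in
/-- The generators of the free commutative superalgebra. -/
noncomputable def gen (x : σ) : FreeSuper p := mk p (FreeAlgebra.ι ℂ x)

theorem gen_mul_gen (x y : σ) : gen p x * gen p y = sgn (p x) (p y) • (gen p y * gen p x) := by
  have : mk p (FreeAlgebra.ι ℂ x * FreeAlgebra.ι ℂ y)
      = mk p (sgn (p x) (p y) • (FreeAlgebra.ι ℂ y * FreeAlgebra.ι ℂ x)) :=
    RingQuot.mkAlgHom_rel ℂ (SuperRel.comm (p := p) x y)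
  rwa [map_mul, map_smul, map_mul] at this

theorem induction {P : FreeSuper p → Prop} (hC : ∀ c : ℂ, P (algebraMap ℂ _ c))
    (hgen : ∀ x, P (gen p x)) (hmul : ∀ a b, P a → P b → P (a * b))
    (hadd : ∀ a b, P a → P b → P (a + b)) (a : FreeSuper p) : P a := by
  obtain ⟨a, rfl⟩ := mk_surjective a
  induction a using FreeAlgebra.induction with
  | grade0 c => rw [AlgHom.commutes]; exact hC c
  | grade1 x => exact hgen x
  | mul a b h h' => rw [map_mul]; exact hmul _ _ h h'
  | add a b h h' => rw [map_add]; exact hadd _ _ h h'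

theorem algHom_ext {B : Type*} [Ring B] [Algebra ℂ B] {φ ψ : FreeSuper p →ₐ[ℂ] B}
    (h : ∀ x, φ (gen p x) = ψ (gen p x)) : φ = ψ :=
  RingQuot.ringQuot_ext' ℂ φ ψ (FreeAlgebra.hom_ext (funext h))

/-- The universal property of the free commutative superalgebra, without parity. -/
noncomputable def lift {B : Type*} [Ring B] [Algebra ℂ B] (v : σ → B)
    (hv : ∀ x y, v x * v y = sgn (p x) (p y) • (v y * v x)) : FreeSuper p →ₐ[ℂ] B :=
  RingQuot.liftAlgHom ℂ ⟨FreeAlgebra.lift ℂ v, by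
    rintro _ _ ⟨x, y⟩
    simpa using hv x y⟩

theorem lift_gen {B : Type*} [Ring B] [Algebra ℂ B] (v : σ → B)
    (hv : ∀ x y, v x * v y = sgn (p x) (p y) • (v y * v x)) (x : σ) :
    lift v hv (gen p x) = v x :=
  (RingQuot.liftAlgHom_mkAlgHom_apply ℂ _ _ _).trans (FreeAlgebra.lift_ι_apply v x)

variable (p) in
/-- The parity involution, `a ↦ (-1)^|a| a` on homogeneous elements. -/
noncomputable def invol : FreeSuper p →ₐ[ℂ] FreeSuper p :=
  lift (fun x => sgn (p x) 1 • gen p x) fun x y => by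
    rw [smul_mul_smul_comm, smul_mul_smul_comm, gen_mul_gen x y, smul_comm, mul_comm]

theorem invol_gen (x : σ) : invol p (gen p x) = sgn (p x) 1 • gen p x := lift_gen _ _ x

theorem invol_invol (a : FreeSuper p) : invol p (invol p a) = a := by
  have : (invol p).comp (invol p) = AlgHom.id ℂ _ := algHom_ext fun x => by
    rw [AlgHom.comp_apply, invol_gen, map_smul, invol_gen, smul_smul, sgn_mul_self, one_smul,
      AlgHom.id_apply]
  exact DFunLike.congr_fun this a

variable (p) in
/-- The homogeneous part of parity `i`: the eigenspace of the parity involution for `(-1)ⁱ`. -/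
noncomputable def part (i : ZMod 2) : Submodule ℂ (FreeSuper p) :=
  LinearMap.eqLocus (invol p).toLinearMap (sgn i 1 • LinearMap.id)

theorem mem_part {i : ZMod 2} {a : FreeSuper p} : a ∈ part p i ↔ invol p a = sgn i 1 • a :=
  Iff.rfl

theorem gen_mem (x : σ) : gen p x ∈ part p (p x) := invol_gen x

theorem sgn_add (i j k : ZMod 2) : sgn (i + j) k = sgn i k * sgn j k := by
  rcases zmod_two_cases i with rfl | rfl <;> rcases zmod_two_cases j with rfl | rfl <;>
    rcases zmod_two_cases k with rfl | rfl <;>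
    simp [sgn, ZMod.val_one, show (1 + 1 : ZMod 2) = 0 from rfl]

/-- Even generators are central, and odd ones commute with everything up to the parity
involution. -/
theorem gen_mul (y : σ) (a : FreeSuper p) :
    gen p y * a = (if p y = 0 then a else invol p a) * gen p y := by
  induction a using FreeSuper.induction with
  | hC c => simp [Algebra.commutes]
  | hgen x =>
    rw [gen_mul_gen]
    rcases zmod_two_cases (p y) with h | h
    · rw [if_pos h, h, sgn_zero_left, one_smul]
    · rw [if_neg (by rw [h]; exact one_ne_zero), invol_gen, h, smul_mul_assoc]
      congr 1
      unfold sgn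
      rw [mul_comm]
  | hmul a b ha hb =>
    rw [← mul_assoc, ha, mul_assoc, hb, ← mul_assoc]
    split_ifs <;> simp
  | hadd a b ha hb =>
    rw [mul_add, ha, hb, ← add_mul]
    split_ifs <;> simp

theorem mul_of_mem_even {a : FreeSuper p} (ha : a ∈ part p 0) (b : FreeSuper p) :
    b * a = a * b := by
  rw [mem_part, sgn_zero_left, one_smul] at ha
  induction b using FreeSuper.induction with
  | hC c => exact Algebra.commutes _ _
  | hgen x => rw [gen_mul, ha, ite_self]
  | hmul b c hb hc => rw [mul_assoc, hc, ← mul_assoc, hb, mul_assoc]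
  | hadd b c hb hc => rw [add_mul, mul_add, hb, hc]

theorem mul_of_mem_odd {a : FreeSuper p} (ha : a ∈ part p 1) (b : FreeSuper p) :
    b * a = a * invol p b := by
  rw [mem_part, sgn_one_one, neg_smul, one_smul] at ha
  induction b using FreeSuper.induction with
  | hC c => rw [AlgHom.commutes]; exact Algebra.commutes _ _
  | hgen x =>
    rw [gen_mul, ha, invol_gen]
    rcases zmod_two_cases (p x) with h | h
    · simp [h, sgn_zero_left]
    · simp [h, sgn_one_one]
  | hmul b c hb hc => rw [mul_assoc, hc, ← mul_assoc, hb, map_mul, mul_assoc]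
  | hadd b c hb hc => rw [add_mul, map_add, mul_add, hb, hc]

end FreeSuper

/-- The free commutative superalgebra on generators of parities prescribed by `p`, that is, the
polynomial superalgebra in even and odd variables. -/
noncomputable def freeCommSuperAlg (p : σ → ZMod 2) : CommSuperAlg.{u} where
  carrier := FreeSuper p
  par := FreeSuper.part p
  isCompl := by
    rw [isCompl_iff, Submodule.disjoint_def, codisjoint_iff, eq_top_iff]
    constructor
    · intro a h0 h1
      rw [FreeSuper.mem_part, sgn_zero_left, one_smul] at h0
      rw [FreeSuper.mem_part, sgn_one_one, h0, neg_smul, one_smul] at h1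
      rw [eq_neg_iff_add_eq_zero, ← two_smul ℂ, smul_eq_zero] at h1
      exact h1.resolve_left two_ne_zero
    · intro a _
      have h : a = (2⁻¹ : ℂ) • (a + FreeSuper.invol p a)
          + (2⁻¹ : ℂ) • (a - FreeSuper.invol p a) := by module
      rw [h]
      refine Submodule.add_mem_sup (Submodule.smul_mem _ _ ?_) (Submodule.smul_mem _ _ ?_)
      · rw [FreeSuper.mem_part, sgn_zero_left, one_smul, map_add, FreeSuper.invol_invol, add_comm]
      · rw [FreeSuper.mem_part, sgn_one_one, map_sub, FreeSuper.invol_invol, neg_smul, one_smul,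
          neg_sub]
  one_mem := by rw [FreeSuper.mem_part, sgn_zero_left, one_smul, map_one]
  mul_mem ha hb := by
    rw [FreeSuper.mem_part] at *
    rw [map_mul, ha, hb, smul_mul_smul_comm, FreeSuper.sgn_add]
  comm {i j a b} ha hb := by
    rcases zmod_two_cases j with rfl | rfl
    · rw [sgn_zero_right, one_smul, FreeSuper.mul_of_mem_even hb]
    · rw [FreeSuper.mul_of_mem_odd hb, FreeSuper.mem_part.1 ha, mul_smul_comm]

instance (p : σ → ZMod 2) [Finite σ] : Algebra.FiniteType ℂ (freeCommSuperAlg p) :=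
  Algebra.FiniteType.of_surjective (FreeSuper.mk p) FreeSuper.mk_surjective

/-- A morphism preserves the parity as soon as it does so on the generators: it then intertwines
the parity involution with that of the target. -/
theorem FreeSuper.map_part {p : σ → ZMod 2} {A : CommSuperAlg.{u}} (φ : FreeSuper p →ₐ[ℂ] A)
    (h : ∀ x, φ (gen p x) ∈ A.par (p x)) :
    ∀ i, ∀ a ∈ part p i, φ a ∈ A.par i := by
  have key : ∀ a, φ (a + invol p a) ∈ A.par 0 ∧ φ (a - invol p a) ∈ A.par 1 := by
    intro a
    induction a using FreeSuper.induction with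
    | hC c =>
      rw [AlgHom.commutes, sub_self, map_zero, ← map_add, AlgHom.commutes,
        Algebra.algebraMap_eq_smul_one]
      exact ⟨Submodule.smul_mem _ _ A.one_mem, Submodule.zero_mem _⟩
    | hgen x =>
      have hx := h x
      rw [invol_gen]
      rcases zmod_two_cases (p x) with hp | hp <;> rw [hp] at hx ⊢
      · rw [sgn_zero_left, one_smul, sub_self, map_zero, map_add]
        exact ⟨Submodule.add_mem _ hx hx, Submodule.zero_mem _⟩
      · rw [sgn_one_one, neg_smul, one_smul, add_neg_cancel, sub_neg_eq_add, map_zero, map_add]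
        exact ⟨Submodule.zero_mem _, Submodule.add_mem _ hx hx⟩
    | hmul a b ha hb =>
      have h1 : a * b + invol p (a * b) = (2⁻¹ : ℂ) • ((a + invol p a) * (b + invol p b)
          + (a - invol p a) * (b - invol p b)) := by
        rw [map_mul, add_mul, mul_add, mul_add, sub_mul, mul_sub, mul_sub]; module
      have h2 : a * b - invol p (a * b) = (2⁻¹ : ℂ) • ((a + invol p a) * (b - invol p b)
          + (a - invol p a) * (b + invol p b)) := by
        rw [map_mul, add_mul, mul_sub, mul_sub, sub_mul, mul_add, mul_add]; module
      rw [h1, h2, map_smul, map_smul, map_add, map_add, map_mul, map_mul, map_mul, map_mul]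
      exact ⟨Submodule.smul_mem _ _ (Submodule.add_mem _ (A.mul_mem ha.1 hb.1)
          (A.mul_mem ha.2 hb.2)),
        Submodule.smul_mem _ _ (Submodule.add_mem _ (A.mul_mem ha.1 hb.2)
          (A.mul_mem ha.2 hb.1))⟩
    | hadd a b ha hb =>
      rw [map_add (invol p), add_add_add_comm, add_sub_add_comm, map_add φ (a + _),
        map_add φ (a - _)]
      exact ⟨Submodule.add_mem _ ha.1 hb.1, Submodule.add_mem _ ha.2 hb.2⟩
  have half : ∀ {i : ZMod 2} {b : A}, b + b ∈ A.par i → b ∈ A.par i := fun {i b} hb => by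
    have := Submodule.smul_mem _ (2⁻¹ : ℂ) hb
    rwa [← two_smul ℂ b, smul_smul, inv_mul_cancel₀ two_ne_zero, one_smul] at this
  intro i a ha
  rw [mem_part] at ha
  have hk := key a
  rcases zmod_two_cases i with rfl | rfl
  · rw [ha, sgn_zero_left, one_smul, map_add] at hk
    exact half hk.1
  · rw [ha, sgn_one_one, neg_smul, one_smul, sub_neg_eq_add, map_add φ a a] at hk
    exact half hk.2

/-- Morphisms from the free commutative superalgebra are families of elements of the prescribed
parities. -/
noncomputable def freeHomEquiv (p : σ → ZMod 2) (A : CommSuperAlg.{u}) :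
    (freeCommSuperAlg p ⟶ A) ≃ ∀ x, A.par (p x) where
  toFun φ x := ⟨φ.toAlgHom (FreeSuper.gen p x), φ.map_par _ _ (FreeSuper.gen_mem x)⟩
  invFun v := ⟨FreeSuper.lift (fun x => (v x : A)) fun x y => A.comm (v x).2 (v y).2,
    FreeSuper.map_part _ fun x => by rw [FreeSuper.lift_gen]; exact (v x).2⟩
  left_inv φ := CommSuperAlg.Hom.ext (FreeSuper.algHom_ext fun x => by
    rw [FreeSuper.lift_gen]; rfl)
  right_inv v := funext fun x => Subtype.ext
    (FreeSuper.lift_gen (fun y => (v y : A)) (fun x y => A.comm (v x).2 (v y).2) x)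

end FreeSuper

/-! ### Representability of the points of a subspace -/

section Coordinates

variable {𝔤 : Type u} [AddCommGroup 𝔤] [Module ℂ 𝔤] [LieSuperalgebra 𝔤]

/-- Linear coordinates on the homogeneous elements of a subspace `W` of `𝔤`: a homogeneous basis of
`W₀ ⊕ W₁` and linear forms on `𝔤` extending the dual basis. -/
structure HomCoords (W : Submodule ℂ 𝔤) (σ : Type u) [Fintype σ] where
  /-- The parities of the basis vectors. -/
  parity : σ → ZMod 2
  /-- The basis vectors. -/
  vec : σ → 𝔤
  /-- The coordinate forms. -/
  coord : σ → 𝔤 →ₗ[ℂ] ℂ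
  vec_mem : ∀ s, vec s ∈ W
  vec_par : ∀ s, vec s ∈ par (parity s)
  /-- The Kronecker delta, written as an indicator function to avoid decidability. -/
  coord_vec : ∀ s t, coord s (vec t) = Set.indicator {s} 1 t
  coord_par : ∀ s, ∀ i, ∀ x ∈ par i, parity s ≠ i → coord s x = 0
  sum_eq : ∀ i, ∀ x ∈ W, x ∈ par i → ∑ s, coord s x • vec s = x

theorem exists_homCoords [FiniteDimensional ℂ 𝔤] (W : Submodule ℂ 𝔤) :
    ∃ (σ : Type u) (_ : Fintype σ), Nonempty (HomCoords W σ) := by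
  classical
  let ι : ZMod 2 → Type u := fun i =>
    Module.Basis.ofVectorSpaceIndex ℂ ↥(W ⊓ par i)
  let b : ∀ i, Module.Basis (ι i) ℂ ↥(W ⊓ par i) := fun i => Module.Basis.ofVectorSpace ℂ _
  have hfin : ∀ i, Finite (ι i) := fun i => Module.Finite.finite_basis (b i)
  have hfin' : ∀ i, Fintype (ι i) := fun i => Fintype.ofFinite _
  choose c hc using fun (s : Σ i, ι i) => LinearMap.exists_extend ((b s.1).coord s.2)
  have hc' : ∀ s : Σ i, ι i, ∀ x : ↥(W ⊓ par s.1), c s x = (b s.1).repr x s.2 :=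
    fun s x => LinearMap.congr_fun (hc s) x
  have hcp : ∀ s : Σ i, ι i, ∀ i, ∀ x ∈ par i, s.1 ≠ i →
      (c s ∘ₗ parityProj 𝔤 s.1) x = 0 := by
    intro s i x hx hs
    rw [LinearMap.comp_apply, parityProj_of_mem hx, if_neg hs, map_zero]
  refine ⟨Σ i, ι i, inferInstance, ⟨⟨fun s => s.1, fun s => b s.1 s.2,
    fun s => c s ∘ₗ parityProj 𝔤 s.1, fun s => (b s.1 s.2).2.1, fun s => (b s.1 s.2).2.2, ?_,
    hcp, ?_⟩⟩⟩
  · rintro ⟨i, s⟩ ⟨j, t⟩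
    by_cases hij : i = j
    · subst hij
      rw [LinearMap.comp_apply, parityProj_of_mem (b i t).2.2, if_pos rfl, hc',
        Module.Basis.repr_self, Finsupp.single_apply]
      simp [Set.indicator_apply]
    · rw [hcp _ _ _ (b j t).2.2 hij]
      simp [Ne.symm hij]
  · intro i x hxW hx
    rw [Fintype.sum_sigma, Finset.sum_eq_single i]
    · have h1 := congrArg Subtype.val ((b i).sum_repr ⟨x, hxW, hx⟩)
      rw [Submodule.coe_sum] at h1
      refine Eq.trans (Finset.sum_congr rfl fun s _ => ?_) h1
      rw [LinearMap.comp_apply, parityProj_of_mem hx, if_pos rfl]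
      exact congrArg (· • (b i s : 𝔤)) (hc' ⟨i, s⟩ ⟨x, hxW, hx⟩)
    · intro j _ hj
      exact Finset.sum_eq_zero fun s _ => by rw [hcp _ _ _ hx hj, zero_smul]
    · simp

namespace HomCoords

variable {W : Submodule ℂ 𝔤} {σ : Type u} [Fintype σ] (d : HomCoords W σ)

/-- The coordinates of an `A`-point. -/
noncomputable def ptCoord (A : CommSuperAlg.{u}) (s : σ) : A ⊗[ℂ] 𝔤 →ₗ[ℂ] A :=
  (TensorProduct.rid ℂ A).toLinearMap ∘ₗ (d.coord s).lTensor A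

theorem ptCoord_tmul {A : CommSuperAlg.{u}} (s : σ) (a : A) (x : 𝔤) :
    d.ptCoord A s (a ⊗ₜ x) = d.coord s x • a := by
  simp [ptCoord]

theorem ptCoord_mem {A : CommSuperAlg.{u}} (s : σ) {t : A ⊗[ℂ] 𝔤} (ht : t ∈ pts ⊤ A) :
    d.ptCoord A s t ∈ A.par (d.parity s) := by
  refine pts_induction (p := fun t => d.ptCoord A s t ∈ A.par (d.parity s)) (by simp)
    (fun s s' h1 h2 => ?_) (fun c s h1 => ?_) (fun i a ha x _ hx => ?_) t ht
  · rw [map_add]; exact Submodule.add_mem _ h1 h2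
  · rw [map_smul]; exact Submodule.smul_mem _ _ h1
  · rw [ptCoord_tmul]
    by_cases hi : d.parity s = i
    · exact Submodule.smul_mem _ _ (hi ▸ ha)
    · rw [d.coord_par s i x hx hi, zero_smul]; exact Submodule.zero_mem _

theorem sum_ptCoord {A : CommSuperAlg.{u}} {t : A ⊗[ℂ] 𝔤} (ht : t ∈ pts W A) :
    ∑ s, d.ptCoord A s t ⊗ₜ[ℂ] d.vec s = t := by
  refine pts_induction (p := fun t => ∑ s, d.ptCoord A s t ⊗ₜ[ℂ] d.vec s = t) (by simp)
    (fun s s' h1 h2 => ?_) (fun c s h1 => ?_) (fun i a ha x hxW hx => ?_) t ht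
  · simp only [map_add, TensorProduct.add_tmul, Finset.sum_add_distrib, h1, h2]
  · simp only [map_smul, ← TensorProduct.smul_tmul', ← Finset.smul_sum, h1]
  · simp only [ptCoord_tmul, TensorProduct.smul_tmul]
    rw [← TensorProduct.tmul_sum, d.sum_eq i x hxW hx]

/-- `W(A)` is the set of families of elements of `A` of the parities of the basis vectors. -/
noncomputable def ptsEquiv (A : CommSuperAlg.{u}) :
    (∀ s, A.par (d.parity s)) ≃ subPts W A where
  toFun v := ⟨⟨∑ s, (v s : A) ⊗ₜ d.vec s, Submodule.sum_mem _ fun s _ =>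
      tmul_mem_pts (v s).2 trivial (d.vec_par s)⟩,
    Submodule.sum_mem (pts W A) fun s _ => tmul_mem_pts (v s).2 (d.vec_mem s) (d.vec_par s)⟩
  invFun t s := ⟨d.ptCoord A s (t : GPts 𝔤 A), d.ptCoord_mem s (t : GPts 𝔤 A).2⟩
  left_inv v := by
    funext s
    refine Subtype.ext ?_
    classical
    simp [ptCoord_tmul, d.coord_vec, Set.indicator_apply]
  right_inv t := Subtype.ext (Subtype.ext (d.sum_ptCoord t.2))

/-- The functor `A ↦ W(A)` is corepresented by the polynomial superalgebra on the coordinates. -/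
noncomputable def homEquiv (A : CommSuperAlg.{u}) :
    (freeCommSuperAlg d.parity ⟶ A) ≃ subPts W A :=
  (freeHomEquiv d.parity A).trans (d.ptsEquiv A)

theorem homEquiv_comp {A B : CommSuperAlg.{u}} (φ : A ⟶ B) (ψ : freeCommSuperAlg d.parity ⟶ A) :
    (d.homEquiv B (ψ ≫ φ) : GPts 𝔤 B) = baseChange φ (d.homEquiv A ψ : GPts 𝔤 A) := by
  refine Subtype.ext ?_
  rw [coe_baseChange]
  change ∑ s, φ.toAlgHom (ψ.toAlgHom (FreeSuper.gen d.parity s)) ⊗ₜ[ℂ] d.vec s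
    = φ.toAlgHom.toLinearMap.rTensor 𝔤
      (∑ s, ψ.toAlgHom (FreeSuper.gen d.parity s) ⊗ₜ[ℂ] d.vec s)
  rw [map_sum]
  rfl

end HomCoords

theorem isAffineSupervariety_of_equiv [FiniteDimensional ℂ 𝔤] (W : Submodule ℂ 𝔤)
    {X : CommSuperAlg.{u} ⥤ Type u} (ε : ∀ A, subPts W A ≃ X.obj A)
    (hε : ∀ {A B : CommSuperAlg.{u}} (φ : A ⟶ B) (t : subPts W A),
      X.map φ (ε A t) = ε B ⟨baseChange φ t.1, baseChange_mem φ t.2⟩) :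
    IsAffineSupervariety X := by
  obtain ⟨σ, _, ⟨d⟩⟩ := exists_homCoords W
  refine ⟨freeCommSuperAlg d.parity, inferInstance, ⟨⟨fun {A} => (d.homEquiv A).trans (ε A),
    fun {A B} φ ψ => ?_⟩⟩⟩
  change ε B (d.homEquiv B (ψ ≫ φ)) = X.map φ (ε A (d.homEquiv A ψ))
  rw [hε]
  exact congrArg _ (Subtype.ext (d.homEquiv_comp φ ψ))

theorem isAffineSupervariety_affineSubspace [FiniteDimensional ℂ 𝔤] {x : 𝔤}
    (hx : x ∈ par (0 : ZMod 2)) (W : Submodule ℂ 𝔤) :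
    IsAffineSupervariety (affineSubspace.{u} hx W) := by
  refine isAffineSupervariety_of_equiv W (fun A =>
    { toFun := fun t => ⟨constPt hx A + t.1, by rw [add_sub_cancel_left]; exact t.2⟩
      invFun := fun X => ⟨X.1 - constPt hx A, X.2⟩
      left_inv := fun t => Subtype.ext (add_sub_cancel_left _ _)
      right_inv := fun X => Subtype.ext (add_sub_cancel _ _) }) fun {A B} φ t => ?_
  refine Subtype.ext ?_
  change baseChange φ (constPt hx A + t.1) = constPt hx B + baseChange φ t.1
  rw [map_add, baseChange_constPt]

theorem isAffineSupervariety_unipotentVariety [FiniteDimensional ℂ 𝔤] {Γ : ℤ → Submodule ℂ 𝔤}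
    {f : 𝔤} (hΓ : IsGoodGrading Γ f) : IsAffineSupervariety (unipotentVariety.{u} hΓ) :=
  isAffineSupervariety_of_equiv (geq Γ 1) (fun A =>
    { toFun := fun t => (⟨t.1, t.2⟩ : GPlus hΓ A)
      invFun := fun (g : GPlus hΓ A) => ⟨g.log, g.log_mem⟩
      left_inv := fun _ => rfl
      right_inv := fun _ => rfl }) fun _ _ => rfl

end Coordinates

end SuperSlodowy

theorem mainTheorem4 {𝔤 : Type u} [AddCommGroup 𝔤] [Module ℂ 𝔤] [FiniteDimensional ℂ 𝔤]
    [SuperSlodowy.LieSuperalgebra 𝔤] (Γ : ℤ → Submodule ℂ 𝔤) (f : 𝔤)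
    (hΓ : SuperSlodowy.IsGoodGrading Γ f) (e h : 𝔤)
    (hsl : SuperSlodowy.IsSl2Triple e h f) (he : e ∈ Γ 2) :
    SuperSlodowy.IsAffineSupervariety (SuperSlodowy.slodowySlice hΓ e) ∧
    SuperSlodowy.IsAffineSupervariety (SuperSlodowy.unipotentVariety hΓ) ∧
    SuperSlodowy.IsAffineSupervariety (SuperSlodowy.affineTarget hΓ) ∧
    ∃ ξ : CategoryTheory.FunctorToTypes.prod (SuperSlodowy.slodowySlice hΓ e)
          (SuperSlodowy.unipotentVariety hΓ) ≅ SuperSlodowy.affineTarget hΓ,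
      ∀ (A : SuperSlodowy.CommSuperAlg.{u}) (X : (SuperSlodowy.slodowySlice hΓ e).obj A)
        (g : SuperSlodowy.GPlus hΓ A),
        (ξ.hom.app A (X, g)).1 = SuperSlodowy.GPlus.Ad g⁻¹ X.1 := by
  have hiso : CategoryTheory.IsIso (SuperSlodowy.conjMap hΓ hsl he) := by
    rw [CategoryTheory.NatTrans.isIso_iff_isIso_app]
    exact fun A => (CategoryTheory.isIso_iff_bijective _).2
      (SuperSlodowy.conjMap_bijective hΓ hsl he A)
  exact ⟨SuperSlodowy.isAffineSupervariety_affineSubspace _ _,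
    SuperSlodowy.isAffineSupervariety_unipotentVariety hΓ,
    SuperSlodowy.isAffineSupervariety_affineSubspace _ _,
    CategoryTheory.asIso (SuperSlodowy.conjMap hΓ hsl he), fun _ _ _ => rfl⟩
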